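/- Let $(\mathbf x_i,y_i)_{i=1}^m\subseteq\mathbb R^d\times\{\pm1\}$ be a data set and let $f(\mathbf x;\bm\theta)$, $\bm\theta\in\mathbb R^p$, be a model such that for every $\mathbf x\in\mathbb R^d$ the map $f(\mathbf x;\cdot)$ is $C^1$ on $\mathbb R^p$ and $f(\mathbf x;\alpha\bm\theta)=\alpha^Lf(\mathbf x;\bm\theta)$ for all $\bm\theta\in\mathbb R^p$, $\alpha>0$, where $L\ge1$ is a fixed real number. Let $\mathcal L(\bm\theta)=\sum_{i=1}^m e^{-\varphi(y_if(\mathbf x_i;\bm\theta))}$, where $\varphi\in C^2(\mathbb R)$ satisfies $0<\varphi'\le\Phi'$ and $0\le\varphi''\le\Phi''$ on $\mathbb R$ for some constants $\Phi',\Phi''$ (for example, the exponential or the logistic loss). Write $\partial F$ for the Clarke subdifferential of $F:\mathbb R^p\to\mathbb R$, i.e. $\partial F(\bm\theta)$ is the convex hull of all limits $\lim_k\nabla F(\bm\theta_k)$ with $\bm\theta_k\to\bm\theta$ and $F$ differentiable at each $\bm\theta_k$ (so $\partial F=\{\nabla F\}$ if $F$ is $C^1$). Let $\eta:[0,\infty)\to(0,\infty)$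 be non-increasing with $\int_0^\infty\eta(t)\,dt=\infty$ and $\eta(t)=o(t^{1/L-1})$ as $t\to\infty$, and let $c_1\ge c_2>0$. Let $\bm\theta_t$, $t\ge0$, be a trajectory of continuous-time Adam without stability constant, that is: $\bm\theta_t$ is absolutely continuous on compact intervals, $\mathbf g_t\in\partial\mathcal L(\bm\theta_t)$ for all $t\ge 0$, and for almost every $t\ge0$ $$\frac{d\bm\theta_t}{dt}=-\eta(t)\,\frac{\hat{\mathbf m}_t}{\sqrt{\hat{\mathbf v}_t}},\qquad \hat{\mathbf m}_t=\frac{1}{1-e^{-c_1t}}\int_0^tc_1e^{-c_1(t-s)}\mathbf g_s\,ds,\qquad \hat{\mathbf v}_t=\frac{1}{1-e^{-c_2t}}\int_0^tc_2e^{-c_2(t-s)}\mathbf g_s^2\,ds,$$ where squares, square roots and quotients are taken coordinatewise. Assume that 1. there are $N_{\min}>0$ and $t_0\ge0$ with $\|\bm\theta_t\|_\infty\ge N_{\min}$ for all $t\ge t_0$; 2. $\bm\theta_t/\|\bm\theta_t\|_\infty$ converges as $t\to\infty$ to some $\bar{\bm\theta}$ with $\gamma(\bar{\bm\theta})>0$,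 where $\gamma(\bm\theta)=\min_{i}y_if(\mathbf x_i;\bm\theta/\|\bm\theta\|_\infty)$; 3. there are $\tau,\rho>0$ such that for every coordinate $j$ and almost every $t\in[0,\tau]$, $\mathbf g_t[j]^2>\rho$. Then $\bar{\bm\theta}$ is the direction of a KKT point of the $\ell_\infty$-max-margin problem $$\min_{\bm\theta\in\mathbb R^p}\tfrac12\|\bm\theta\|_\infty^2\quad\text{s.t.}\quad y_if(\mathbf x_i;\bm\theta)\ge1\ \text{ for all }i=1,\dots,m.$$ That is, there is $\bm\theta^*\ne\mathbf 0$ with $\bar{\bm\theta}=\bm\theta^*/\|\bm\theta^*\|_\infty$ such that $y_if(\mathbf x_i;\bm\theta^*)\ge1$ for all $i$ and there exist $\mathbf k\in\partial\big(\tfrac12\|\cdot\|_\infty^2\big)(\bm\theta^*)$, $\lambda_1,\dots,\lambda_m\ge0$ and $\mathbf h_i\in\partial f(\mathbf x_i;\cdot)(\bm\theta^*)$ with $\sum_i\lambda_iy_i\mathbf h_i-\mathbf k=\mathbf 0$ and $\sum_i\lambda_i\big(y_if(\mathbf x_i;\bm\theta^*)-1\big)=0$. -/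

import Mathlib

open Filter Topology MeasureTheory Asymptotics

/- Parameters live in `Fin p → ℝ`, whose norm in Mathlib is the sup norm: `‖θ‖` is the
`ℓ^∞` norm of `θ` throughout. -/

/-- The gradient of `F` at `θ`, as the vector of partial derivatives. -/
noncomputable def gradVec {p : ℕ} (F : (Fin p → ℝ) → ℝ) (θ : Fin p → ℝ) : Fin p → ℝ :=
  fun j => fderiv ℝ F θ (Pi.single j 1)

/-- The Clarke subdifferential of `F` at `θ`: the convex hull of all limits of gradients
`∇F(u k)` along sequences `u k → θ` of points at which `F` is differentiable. -/
def clarkeSubdiff {p : ℕ} (F : (Fin p → ℝ) → ℝ) (θ : Fin p → ℝ) : Set (Fin p → ℝ) :=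
  convexHull ℝ {h | ∃ u : ℕ → Fin p → ℝ, Tendsto u atTop (𝓝 θ) ∧
    (∀ k, DifferentiableAt ℝ F (u k)) ∧ Tendsto (fun k => gradVec F (u k)) atTop (𝓝 h)}

/-- The per-sample loss is `ℓ(u) = exp (-φ u)`; this is the condition on `φ` for `ℓ` to be a
log-concave, exponentially tailed loss. -/
structure IsLossExponent (φ : ℝ → ℝ) : Prop where
  contDiff : ContDiff ℝ 2 φ
  deriv_pos : ∀ u, 0 < deriv φ u
  deriv_bdd : ∃ M : ℝ, ∀ u, deriv φ u ≤ M
  deriv2_nonneg : ∀ u, 0 ≤ deriv (deriv φ) u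
  deriv2_bdd : ∃ M : ℝ, ∀ u, deriv (deriv φ) u ≤ M

/-- The training loss `𝓛(θ) = ∑ i, exp (-φ (y i * f (x i; θ)))`. -/
noncomputable def trainLoss {d p m : ℕ} (φ : ℝ → ℝ) (f : (Fin d → ℝ) → (Fin p → ℝ) → ℝ)
    (x : Fin m → Fin d → ℝ) (y : Fin m → ℝ) (θ : Fin p → ℝ) : ℝ :=
  ∑ i, Real.exp (-φ (y i * f (x i) θ))

/-- `f` is positively homogeneous of degree `L` in the parameters. -/
def IsHomogeneousModel {d p : ℕ} (L : ℝ) (f : (Fin d → ℝ) → (Fin p → ℝ) → ℝ) : Prop :=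
  ∀ (x : Fin d → ℝ) (θ : Fin p → ℝ) (α : ℝ), 0 < α → f x (α • θ) = α ^ L * f x θ

/-- The margin `γ(θ) = min_i y i * f (x i; θ / ‖θ‖)`, with respect to the `ℓ^∞` norm. -/
noncomputable def margin {d p m : ℕ} (f : (Fin d → ℝ) → (Fin p → ℝ) → ℝ)
    (x : Fin m → Fin d → ℝ) (y : Fin m → ℝ) (θ : Fin p → ℝ) : ℝ :=
  ⨅ i, y i * f (x i) (‖θ‖⁻¹ • θ)

/-- `θ` is an arc on `[0, ∞)`: locally absolutely continuous, i.e. the integral of a locally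
integrable function. -/
def IsArc {p : ℕ} (θ : ℝ → Fin p → ℝ) : Prop :=
  ∃ θ' : ℝ → Fin p → ℝ, ∀ t, 0 ≤ t →
    IntervalIntegrable θ' volume 0 t ∧ θ t = θ 0 + ∫ s in (0 : ℝ)..t, θ' s

/-- The momentum (exponential moving average) `∫₀ᵗ c e^{-c (t - s)} h(s) ds`. -/
noncomputable def ema (c : ℝ) (h : ℝ → ℝ) (t : ℝ) : ℝ :=
  ∫ s in (0 : ℝ)..t, c * Real.exp (-c * (t - s)) * h s

/-- The momentum with bias correction, `(1 - e^{-c t})⁻¹ ∫₀ᵗ c e^{-c (t - s)} h(s) ds`. -/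
noncomputable def emaHat (c : ℝ) (h : ℝ → ℝ) (t : ℝ) : ℝ :=
  (1 - Real.exp (-c * t))⁻¹ * ema c h t

/-- `θ` is a trajectory of continuous-time Adam without stability constant, for the objective
`F`, the learning rate `η` and the momentum parameters `c₁`, `c₂`; `g t` is the subgradient used
at time `t`. Coordinatewise, `dθ/dt = - η(t) m̂_t / √v̂_t` for almost every `t ≥ 0`. -/
structure IsAdamTrajectory {p : ℕ} (F : (Fin p → ℝ) → ℝ) (η : ℝ → ℝ) (c₁ c₂ : ℝ)
    (θ g : ℝ → Fin p → ℝ) : Prop where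
  arc : IsArc θ
  subgradient : ∀ t, 0 ≤ t → g t ∈ clarkeSubdiff F (θ t)
  ode : ∀ᵐ t ∂(volume.restrict (Set.Ici (0 : ℝ))),
    HasDerivAt θ (fun j => -η t *
      (emaHat c₁ (fun s => g s j) t / Real.sqrt (emaHat c₂ (fun s => g s j ^ 2) t))) t

/-- `θ` is a KKT point of `min ½ ‖θ‖²` subject to `y i * f (x i; θ) ≥ 1` for all `i`, for the
`ℓ^∞` norm `‖θ‖`. -/
def IsKKTPoint {d p m : ℕ} (f : (Fin d → ℝ) → (Fin p → ℝ) → ℝ)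
    (x : Fin m → Fin d → ℝ) (y : Fin m → ℝ) (θ : Fin p → ℝ) : Prop :=
  (∀ i, 1 ≤ y i * f (x i) θ) ∧
  ∃ k ∈ clarkeSubdiff (fun ϑ : Fin p → ℝ => (1 / 2 : ℝ) * ‖ϑ‖ ^ 2) θ,
  ∃ (l : Fin m → ℝ) (h : Fin m → Fin p → ℝ),
    (∀ i, 0 ≤ l i) ∧ (∀ i, h i ∈ clarkeSubdiff (f (x i)) θ) ∧
    (∑ i, (l i * y i) • h i) - k = 0 ∧
    ∑ i, l i * (y i * f (x i) θ - 1) = 0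

/-! ### Gradients and Clarke subdifferentials -/

/-! Write `w` for the limit direction, `γ` for its margin and `F i = y i * f (x i)`. Homogeneity
reduces the KKT conditions to the existence of a convex combination `G = ∑ l i ∇F i w` with `‖G‖₁ ≤
L γ`. Indeed Euler's identity gives `⟨w, G⟩ = L ∑ l i F i w ≥ L γ`, and `‖w‖_∞ = 1` gives `⟨w, G⟩ ≤
‖G‖₁`. All these quantities then coincide, which yields complementary slackness and makes `G` a
multiple of a dual vector of `w` (`exists_isKKTPoint_of_sum_abs_le`).

If no such combination exists, compactness of the simplex gives `ε > 0` with `‖G‖₁ ≥ L γ + ε` for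
all of them. Two properties of the Adam direction `U = m̂ / √v̂` contradict this.

Duality (`eventually_descent`): `⟨U, g⟩` is at least the `ℓ¹` norm of the gradient up to `o(A)`,
where the scale `A` is the sum of the weights of the `∇F i` in the gradient. As `η = o(t^(1/L-1))`
while `‖θ‖ = O(t^(1/L))`, the product `η ‖θ‖^(L-1)` tends to `0`, so the logarithms of the weights
have Lipschitz constants tending to `0`. Over the memory of the averages the gradient is thus nearly
constant relative to `A`, and `m̂ ≈ g`, `v̂ ≈ g²`, with errors measured in `A` and `A²`. No
coordinate has to be bounded below relative to `A`.

Speed (`exists_norm_le_integral_rate`): `‖θ‖_∞ ≤ ∫ η + O(1)`, although `|U|` may exceed `1`. By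
Jensen `U²` is at most the ratio of the averages of `g²` at rates `c₁ ≥ c₂`, and this ratio is at
most `1 + Ψ'` with `Ψ` bounded above (`exists_ema_potential`). The excess `∫ η Ψ'` stays bounded
since `η` is non-increasing.

With `ℓ` the loss and `κ = sup φ'`, duality makes `(-log ℓ)^(1/L)` grow faster than `(κ γ)^(1/L) ∫
η`, by a fixed factor. But `-log ℓ` is at most about `κ γ ‖θ‖^L`, so speed bounds the same quantity
by about `(κ γ)^(1/L) ∫ η`. Since `∫ η = ∞` this is impossible (`not_eventually_descent`). -/

lemma continuous_gradVec {p : ℕ} {F : (Fin p → ℝ) → ℝ} (hF : ContDiff ℝ 1 F) :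
    Continuous (gradVec F) :=
  continuous_pi fun _ => (hF.continuous_fderiv one_ne_zero).clm_apply continuous_const

lemma clarkeSubdiff_of_contDiff {p : ℕ} {F : (Fin p → ℝ) → ℝ} (hF : ContDiff ℝ 1 F)
    (θ : Fin p → ℝ) : clarkeSubdiff F θ = {gradVec F θ} := by
  have h : {h | ∃ u : ℕ → Fin p → ℝ, Tendsto u atTop (𝓝 θ) ∧
      (∀ k, DifferentiableAt ℝ F (u k)) ∧ Tendsto (fun k => gradVec F (u k)) atTop (𝓝 h)}
      = {gradVec F θ} := by
    ext h
    constructor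
    · rintro ⟨u, hu, -, hlim⟩
      exact tendsto_nhds_unique hlim (((continuous_gradVec hF).tendsto θ).comp hu)
    · rintro rfl
      exact ⟨fun _ => θ, tendsto_const_nhds, fun _ => hF.differentiable one_ne_zero θ,
        tendsto_const_nhds⟩
  rw [clarkeSubdiff, h, convexHull_singleton]

lemma fderiv_apply_eq_sum {p : ℕ} (F : (Fin p → ℝ) → ℝ) (θ v : Fin p → ℝ) :
    fderiv ℝ F θ v = ∑ j, v j * gradVec F θ j := by
  have := LinearMap.pi_apply_eq_sum_univ (fderiv ℝ F θ : (Fin p → ℝ) →ₗ[ℝ] ℝ) v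
  simp only [ContinuousLinearMap.coe_coe, smul_eq_mul] at this
  rw [this]
  refine Finset.sum_congr rfl fun j _ => ?_
  rw [gradVec]
  congr 2
  ext i
  simp [Pi.single_apply, eq_comm]

/-! ### Homogeneous functions -/

lemma gradVec_smul_of_homogeneous {p : ℕ} {F : (Fin p → ℝ) → ℝ} (hF : ContDiff ℝ 1 F) {L : ℝ}
    (hhom : ∀ (θ : Fin p → ℝ) (α : ℝ), 0 < α → F (α • θ) = α ^ L * F θ)
    (θ : Fin p → ℝ) {α : ℝ} (hα : 0 < α) :
    gradVec F (α • θ) = α ^ (L - 1) • gradVec F θ := by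
  have hd := hF.differentiable one_ne_zero
  have h1 : HasFDerivAt (fun ϑ : Fin p → ℝ => F (α • ϑ))
      ((fderiv ℝ F (α • θ)).comp (α • ContinuousLinearMap.id ℝ (Fin p → ℝ))) θ :=
    (hd (α • θ)).hasFDerivAt.comp θ ((hasFDerivAt_id θ).const_smul α)
  have h2 : HasFDerivAt (fun ϑ : Fin p → ℝ => F (α • ϑ)) (α ^ L • fderiv ℝ F θ) θ := by
    have : (fun ϑ : Fin p → ℝ => F (α • ϑ)) = fun ϑ => α ^ L * F ϑ := by
      ext ϑ; exact hhom ϑ α hα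
    rw [this]
    exact (hd θ).hasFDerivAt.const_mul _
  have h3 := h1.unique h2
  ext j
  have h4 := congrArg (fun T : (Fin p → ℝ) →L[ℝ] ℝ => T (Pi.single j 1)) h3
  simp only [ContinuousLinearMap.comp_apply, smul_apply,
    ContinuousLinearMap.id_apply, map_smul, smul_eq_mul] at h4
  simp only [gradVec, Pi.smul_apply, smul_eq_mul]
  rw [Real.rpow_sub_one hα.ne', div_mul_eq_mul_div, eq_div_iff hα.ne', mul_comm, h4]

/-- Euler's identity: both sides are the derivative of `α ↦ F (α • θ)` at `α = 1`. -/
lemma sum_mul_gradVec_of_homogeneous {p : ℕ} {F : (Fin p → ℝ) → ℝ} (hF : ContDiff ℝ 1 F) {L : ℝ}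
    (hhom : ∀ (θ : Fin p → ℝ) (α : ℝ), 0 < α → F (α • θ) = α ^ L * F θ) (θ : Fin p → ℝ) :
    ∑ j, θ j * gradVec F θ j = L * F θ := by
  have hd := hF.differentiable one_ne_zero
  have h1 : HasDerivAt (fun α : ℝ => F (α • θ)) (fderiv ℝ F θ θ) 1 := by
    have h := (hasDerivAt_id (1 : ℝ)).smul_const θ
    have h0 : HasFDerivAt F (fderiv ℝ F θ) ((1 : ℝ) • θ) := by
      rw [one_smul]; exact (hd θ).hasFDerivAt
    have h2 := h0.comp_hasDerivAt (1 : ℝ) h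
    rw [one_smul] at h2
    exact h2
  have h2 : HasDerivAt (fun α : ℝ => F (α • θ)) (L * F θ) 1 := by
    have h := ((Real.hasDerivAt_rpow_const (x := 1) (p := L) (Or.inl one_ne_zero))).mul_const (F θ)
    simp only [Real.one_rpow, mul_one] at h
    refine h.congr_of_eventuallyEq ?_
    filter_upwards [lt_mem_nhds (zero_lt_one' ℝ)] with α hα using hhom θ α hα
  rw [← fderiv_apply_eq_sum, h1.unique h2]

/-! ### The subdifferential of the squared sup norm -/

lemma eventually_norm_eq_abs {p : ℕ} {v : Fin p → ℝ} {j : Fin p}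
    (hj : ∀ i, i ≠ j → |v i| < |v j|) : ∀ᶠ u in 𝓝 v, ‖u‖ = |u j| := by
  have h : ∀ i, ∀ᶠ u : Fin p → ℝ in 𝓝 v, |u i| ≤ |u j| := by
    intro i
    by_cases hij : i = j
    · subst hij; exact Eventually.of_forall fun _ => le_rfl
    · have h1 : Tendsto (fun u : Fin p → ℝ => |u i|) (𝓝 v) (𝓝 |v i|) :=
        ((continuous_apply i).abs).tendsto v
      have h2 : Tendsto (fun u : Fin p → ℝ => |u j|) (𝓝 v) (𝓝 |v j|) :=
        ((continuous_apply j).abs).tendsto v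
      exact (h1.eventually_lt h2 (hj i hij)).mono fun _ h => h.le
  filter_upwards [eventually_all.2 h] with u hu
  refine le_antisymm ((pi_norm_le_iff_of_nonneg (abs_nonneg _)).2 hu) (norm_le_pi_norm u j)

/-- When one coordinate strictly dominates, the sup norm is locally the absolute value of that
coordinate, and its square is smooth. -/
lemma gradVec_half_norm_sq {p : ℕ} {v : Fin p → ℝ} {j : Fin p}
    (hj : ∀ i, i ≠ j → |v i| < |v j|) :
    DifferentiableAt ℝ (fun ϑ : Fin p → ℝ => (1 / 2 : ℝ) * ‖ϑ‖ ^ 2) v ∧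
      gradVec (fun ϑ : Fin p → ℝ => (1 / 2 : ℝ) * ‖ϑ‖ ^ 2) v = Pi.single j (v j) := by
  have h0 : HasFDerivAt (fun ϑ : Fin p → ℝ => (1 / 2 : ℝ) * (ϑ j) ^ 2)
      (v j • ContinuousLinearMap.proj (R := ℝ) (φ := fun _ : Fin p => ℝ) j) v := by
    have h := ((ContinuousLinearMap.proj (R := ℝ) (φ := fun _ : Fin p => ℝ) j).hasFDerivAt
      (x := v)).pow 2 |>.const_mul (1 / 2 : ℝ)
    refine h.congr_fderiv ?_
    ext u
    simp
    ring
  have h1 : HasFDerivAt (fun ϑ : Fin p → ℝ => (1 / 2 : ℝ) * ‖ϑ‖ ^ 2)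
      (v j • ContinuousLinearMap.proj (R := ℝ) (φ := fun _ : Fin p => ℝ) j) v := by
    refine h0.congr_of_eventuallyEq ?_
    filter_upwards [eventually_norm_eq_abs hj] with u hu
    rw [hu, sq_abs]
  refine ⟨h1.differentiableAt, ?_⟩
  ext i
  rw [gradVec, h1.fderiv]
  simp [Pi.single_apply, eq_comm]

/-- Stretching coordinate `j` slightly breaks all ties in its favour, so `v` is a limit of points of
differentiability whose gradients are supported on `j`. -/
lemma single_mem_clarkeSubdiff_half_norm_sq {p : ℕ} {v : Fin p → ℝ} {j : Fin p}
    (hj : |v j| = ‖v‖) (hv : v j ≠ 0) :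
    Pi.single j (v j) ∈ clarkeSubdiff (fun ϑ : Fin p → ℝ => (1 / 2 : ℝ) * ‖ϑ‖ ^ 2) v := by
  apply subset_convexHull
  set u : ℕ → Fin p → ℝ := fun k => v + Pi.single j ((1 / ((k : ℝ) + 1)) * v j) with hu
  have hlim : Tendsto u atTop (𝓝 v) := by
    have h := (tendsto_one_div_add_atTop_nhds_zero_nat (𝕜 := ℝ)).mul_const (v j)
    have h2 := ((continuous_single (A := fun _ : Fin p => ℝ) j).tendsto _).comp h
    have h3 := h2.const_add v
    simp only [zero_mul, Pi.single_zero, add_zero] at h3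
    exact h3
  have huj : ∀ k, u k j = (1 + 1 / ((k : ℝ) + 1)) * v j := by
    intro k; simp [hu]; ring
  have hdom : ∀ k i, i ≠ j → |u k i| < |u k j| := by
    intro k i hij
    have hk : 0 < 1 / ((k : ℝ) + 1) := by positivity
    have h1 : u k i = v i := by simp [hu, hij]
    rw [h1, huj, abs_mul, abs_of_pos (show 0 < 1 + 1 / ((k : ℝ) + 1) by linarith)]
    have h2 : |v i| ≤ |v j| := by rw [hj]; exact norm_le_pi_norm v i
    have h3 : 0 < |v j| := abs_pos.2 hv
    nlinarith
  refine ⟨u, hlim, fun k => (gradVec_half_norm_sq (hdom k)).1, ?_⟩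
  simp only [fun k => (gradVec_half_norm_sq (hdom k)).2]
  exact ((continuous_single (A := fun _ : Fin p => ℝ) j).tendsto _).comp
    ((tendsto_pi_nhds.1 hlim) j)

/-- A vector `k` with `‖k‖₁ = 1` and `⟨k, v⟩ = ‖v‖` yields the subgradient `‖v‖ k` of
`½ ‖·‖²` at `v`. -/
lemma smul_mem_clarkeSubdiff_half_norm_sq {p : ℕ} {v k : Fin p → ℝ} (hv : v ≠ 0)
    (hk1 : ∑ j, |k j| = 1) (hkv : ∑ j, v j * k j = ‖v‖) :
    ‖v‖ • k ∈ clarkeSubdiff (fun ϑ : Fin p → ℝ => (1 / 2 : ℝ) * ‖ϑ‖ ^ 2) v := by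
  have hvpos : 0 < ‖v‖ := norm_pos_iff.2 hv
  have hle : ∀ j, v j * k j ≤ ‖v‖ * |k j| := fun j =>
    (le_abs_self _).trans ((abs_mul _ _).le.trans
      (mul_le_mul_of_nonneg_right (norm_le_pi_norm v j) (abs_nonneg _)))
  -- Equality in Hölder's inequality forces equality in every coordinate, so `k` is supported on the
  -- coordinates where `|v j|` is maximal.
  have heq : ∀ j, v j * k j = ‖v‖ * |k j| := by
    have hs : ∑ j, v j * k j = ∑ j, ‖v‖ * |k j| := by rw [← Finset.mul_sum, hk1, hkv, mul_one]
    intro j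
    exact (Finset.sum_eq_sum_iff_of_le fun j _ => hle j).1 hs j (Finset.mem_univ j)
  have hact : ∀ j, k j ≠ 0 → |v j| = ‖v‖ := by
    intro j hj
    have h1 : |v j| * |k j| = ‖v‖ * |k j| := by
      rw [← abs_mul, heq j, abs_of_nonneg (by positivity)]
    exact mul_right_cancel₀ (abs_ne_zero.2 hj) h1
  -- The `|k j|` are convex weights, and `‖v‖ * k j = |k j| * v j` because `k j` has the sign of `v
  -- j`.
  have hrep : ‖v‖ • k = ∑ j with k j ≠ 0, |k j| • (Pi.single j (v j) : Fin p → ℝ) := by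
    have h1 : ∀ j, k j ≠ 0 → ‖v‖ * k j = |k j| * v j := by
      intro j hj
      have h2 := heq j
      have h3 := hact j hj
      have h4 : v j ^ 2 = ‖v‖ ^ 2 := by rw [← h3, sq_abs]
      have h5 : v j ≠ 0 := by intro h0; rw [h0, abs_zero] at h3; exact hvpos.ne h3
      apply mul_left_cancel₀ h5
      calc v j * (‖v‖ * k j) = ‖v‖ * (v j * k j) := by ring
        _ = ‖v‖ ^ 2 * |k j| := by rw [h2]; ring
        _ = v j * (|k j| * v j) := by rw [← h4]; ring
    ext i
    rw [Finset.sum_apply]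
    simp only [Pi.smul_apply, smul_eq_mul, Pi.single_apply, mul_ite, mul_zero]
    rw [Finset.sum_ite_eq]
    by_cases hi : k i = 0
    · simp [hi]
    · simp [hi, h1 i hi]
  rw [hrep]
  refine (convex_convexHull ℝ _).sum_mem (fun j _ => abs_nonneg _) ?_ ?_
  · rw [← hk1]
    refine Finset.sum_subset (Finset.filter_subset _ _) ?_
    intro j _ hj
    simpa using hj
  · intro j hj
    have hj' : k j ≠ 0 := by simpa using hj
    refine single_mem_clarkeSubdiff_half_norm_sq (hact j hj') ?_
    intro h0
    have := hact j hj'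
    rw [h0, abs_zero] at this
    exact hvpos.ne this

/-! ### Reduction of the KKT conditions to an `ℓ¹` bound -/

/-- If a convex combination `G` of the vectors `y i • ∇f(x i; w)` at a unit vector `w` satisfies
`‖G‖₁ ≤ L γ`, where `γ` is a lower bound for the margin at `w`, then `w` is the direction of a
KKT point. -/
lemma exists_isKKTPoint_of_sum_abs_le {d p m : ℕ}
    {x : Fin m → Fin d → ℝ} {y : Fin m → ℝ} {f : (Fin d → ℝ) → (Fin p → ℝ) → ℝ}
    (hf : ∀ a : Fin d → ℝ, ContDiff ℝ 1 (f a)) {L : ℝ} (hL : 1 ≤ L)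
    (hhom : IsHomogeneousModel L f) {w : Fin p → ℝ} (hw : ‖w‖ = 1) {γ : ℝ} (hγ : 0 < γ)
    (hmar : ∀ i, γ ≤ y i * f (x i) w) {l : Fin m → ℝ} (hl : ∀ i, 0 ≤ l i) (hl1 : ∑ i, l i = 1)
    (hG : ∑ j, |∑ i, l i * y i * gradVec (f (x i)) w j| ≤ L * γ) :
    ∃ θstar : Fin p → ℝ, θstar ≠ 0 ∧ IsKKTPoint f x y θstar ∧ ‖θstar‖⁻¹ • θstar = w := by
  have hLpos : 0 < L := by linarith
  have hw0 : w ≠ 0 := by rw [← norm_ne_zero_iff, hw]; exact one_ne_zero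
  set G : Fin p → ℝ := fun j => ∑ i, l i * y i * gradVec (f (x i)) w j with hGdef
  have hGw : ∑ j, w j * G j = L * ∑ i, l i * (y i * f (x i) w) := by
    calc ∑ j, w j * G j = ∑ i, l i * y i * ∑ j, w j * gradVec (f (x i)) w j := by
          simp only [hGdef, Finset.mul_sum]
          rw [Finset.sum_comm]
          refine Finset.sum_congr rfl fun i _ => Finset.sum_congr rfl fun j _ => by ring
      _ = _ := by
          rw [Finset.mul_sum]
          refine Finset.sum_congr rfl fun i _ => ?_
          rw [sum_mul_gradVec_of_homogeneous (hf _) (hhom (x i))]; ring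
  have hsum : γ ≤ ∑ i, l i * (y i * f (x i) w) := by
    calc γ = ∑ i, l i * γ := by rw [← Finset.sum_mul, hl1, one_mul]
      _ ≤ _ := Finset.sum_le_sum fun i _ => mul_le_mul_of_nonneg_left (hmar i) (hl i)
  have hdual : ∑ j, w j * G j ≤ ∑ j, |G j| := by
    refine Finset.sum_le_sum fun j _ => (le_abs_self _).trans ?_
    rw [abs_mul]
    have : |w j| ≤ 1 := hw ▸ norm_le_pi_norm w j
    nlinarith [abs_nonneg (G j)]
  have hchain : L * γ ≤ ∑ j, w j * G j := by
    rw [hGw]; exact mul_le_mul_of_nonneg_left hsum hLpos.le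
  -- The chain `L γ ≤ ⟨w, G⟩ ≤ ‖G‖₁ ≤ L γ` closes up; each equality extracted from it becomes one
  -- KKT condition.
  have hG1 : ∑ j, |G j| = L * γ := le_antisymm hG (hchain.trans hdual)
  have hGw' : ∑ j, w j * G j = L * γ := le_antisymm (hdual.trans hG) hchain
  have hslack : ∑ i, l i * (y i * f (x i) w) = γ := by
    rw [hGw] at hGw'
    exact mul_left_cancel₀ hLpos.ne' hGw'
  -- The scaling of `w` for which the lower bound `γ` on the margins becomes exactly `1`.
  set α : ℝ := γ ^ (-(1 / L)) with hα
  have hαpos : 0 < α := Real.rpow_pos_of_pos hγ _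
  have hαL : α ^ L * γ = 1 := by
    rw [hα, ← Real.rpow_mul hγ.le, neg_mul, one_div, inv_mul_cancel₀ hLpos.ne',
      Real.rpow_neg_one, inv_mul_cancel₀ hγ.ne']
  have hnorm : ‖α • w‖ = α := by rw [norm_smul, hw, mul_one, Real.norm_of_nonneg hαpos.le]
  have hαw : α • w ≠ 0 := by rw [← norm_ne_zero_iff, hnorm]; exact hαpos.ne'
  have hval : ∀ i, y i * f (x i) (α • w) = α ^ L * (y i * f (x i) w) := by
    intro i; rw [hhom (x i) w α hαpos]; ring
  refine ⟨α • w, hαw, ⟨fun i => ?_, ?_⟩, ?_⟩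
  · rw [hval, ← hαL]
    exact mul_le_mul_of_nonneg_left (hmar i) (Real.rpow_nonneg hαpos.le _)
  -- The gradients at `α • w` are `α ^ (L - 1)` times those at `w`; `μ` solves `μ * α ^ (L - 1) = α
  -- / (L * γ)`, the factor of `G` in the subgradient of `½ ‖·‖²`.
  · set μ : ℝ := α / (L * γ) / α ^ (L - 1) with hμ
    have hμnn : 0 ≤ μ := by positivity
    refine ⟨‖α • w‖ • ((L * γ)⁻¹ • G), ?_, fun i => μ * l i,
      fun i => gradVec (f (x i)) (α • w), fun i => mul_nonneg hμnn (hl i), fun i => ?_, ?_, ?_⟩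
    · have hLγ : 0 < L * γ := by positivity
      refine smul_mem_clarkeSubdiff_half_norm_sq hαw ?_ ?_
      · simp only [Pi.smul_apply, smul_eq_mul, abs_mul]
        rw [← Finset.mul_sum, hG1, abs_of_pos (inv_pos.2 hLγ), inv_mul_cancel₀ hLγ.ne']
      · have : ∀ j, (α • w) j * ((L * γ)⁻¹ • G) j = α * (L * γ)⁻¹ * (w j * G j) := by
          intro j; simp only [Pi.smul_apply, smul_eq_mul]; ring
        simp only [this]
        rw [← Finset.mul_sum, hGw', hnorm, mul_assoc, inv_mul_cancel₀ hLγ.ne', mul_one]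
    · rw [clarkeSubdiff_of_contDiff (hf _)]; rfl
    · rw [sub_eq_zero, hnorm]
      ext j
      simp only [Finset.sum_apply, Pi.smul_apply, smul_eq_mul, hGdef, Finset.mul_sum]
      refine Finset.sum_congr rfl fun i _ => ?_
      rw [gradVec_smul_of_homogeneous (hf _) (hhom (x i)) w hαpos]
      simp only [Pi.smul_apply, smul_eq_mul]
      have h1 : α ^ (L - 1) ≠ 0 := (Real.rpow_pos_of_pos hαpos _).ne'
      rw [hμ]
      field_simp
    · have h1 : ∀ i, μ * l i * (y i * f (x i) (α • w) - 1)
          = μ * (α ^ L * (l i * (y i * f (x i) w)) - l i) := by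
        intro i; rw [hval]; ring
      simp only [h1]
      rw [← Finset.mul_sum, Finset.sum_sub_distrib, ← Finset.mul_sum, hslack, hl1, hαL, sub_self,
        mul_zero]
  · rw [hnorm, smul_smul, inv_mul_cancel₀ hαpos.ne', one_smul]

/-! ### Exponential moving averages -/

/-- Splitting the kernel leaves an integrand independent of `t`, ready for differentiation in the
endpoint. -/
lemma ema_eq (c : ℝ) (h : ℝ → ℝ) (t : ℝ) :
    ema c h t = Real.exp (-c * t) * ∫ s in (0 : ℝ)..t, c * Real.exp (c * s) * h s := by
  rw [ema, ← intervalIntegral.integral_const_mul]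
  refine intervalIntegral.integral_congr fun s _ => ?_
  have : Real.exp (-c * (t - s)) = Real.exp (-c * t) * Real.exp (c * s) := by
    rw [← Real.exp_add]; ring_nf
  simp only [this]; ring

lemma continuous_ema_kernel {h : ℝ → ℝ} (hh : Continuous h) (c t : ℝ) :
    Continuous fun s => c * Real.exp (-c * (t - s)) * h s := by fun_prop

lemma hasDerivAt_ema {h : ℝ → ℝ} (hh : Continuous h) (c t : ℝ) :
    HasDerivAt (ema c h) (c * (h t - ema c h t)) t := by
  have h1 : HasDerivAt (fun t => ∫ s in (0 : ℝ)..t, c * Real.exp (c * s) * h s)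
      (c * Real.exp (c * t) * h t) t := by
    have hc : Continuous fun s => c * Real.exp (c * s) * h s := by fun_prop
    exact intervalIntegral.integral_hasDerivAt_right (hc.intervalIntegrable _ _)
      (hc.stronglyMeasurableAtFilter _ _) hc.continuousAt
  have h2 : HasDerivAt (fun t => Real.exp (-c * t)) (Real.exp (-c * t) * (-c)) t := by
    simpa using ((hasDerivAt_id t).const_mul (-c)).exp
  have h3 := h2.mul h1
  have h4 : ema c h = (fun t => Real.exp (-c * t)) *
      fun t => ∫ s in (0 : ℝ)..t, c * Real.exp (c * s) * h s := by
    ext t; exact ema_eq c h t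
  rw [h4]
  refine h3.congr_deriv ?_
  have h5 : Real.exp (-c * t) * Real.exp (c * t) = 1 := by
    rw [← Real.exp_add]; simp
  simp only [Pi.mul_apply]
  linear_combination (c * h t) * h5

lemma continuous_ema {h : ℝ → ℝ} (hh : Continuous h) (c : ℝ) : Continuous (ema c h) :=
  continuous_iff_continuousAt.2 fun t => (hasDerivAt_ema hh c t).continuousAt

lemma ema_const (c a t : ℝ) : ema c (fun _ => a) t = a * (1 - Real.exp (-c * t)) := by
  have h1 : ∀ s ∈ Set.uIcc 0 t, HasDerivAt (fun s => a * Real.exp (-c * (t - s)))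
      (c * Real.exp (-c * (t - s)) * a) s := by
    intro s _
    have h := ((((hasDerivAt_id s).const_sub t).const_mul (-c)).exp).const_mul a
    refine h.congr_deriv ?_
    simp; ring
  rw [ema, intervalIntegral.integral_eq_sub_of_hasDerivAt h1
    ((by fun_prop : Continuous fun s => c * Real.exp (-c * (t - s)) * a).intervalIntegrable _ _)]
  simp; ring

lemma ema_congr {c t : ℝ} (ht : 0 ≤ t) {h k : ℝ → ℝ} (hk : ∀ s, 0 ≤ s → h s = k s) :
    ema c h t = ema c k t := by
  refine intervalIntegral.integral_congr fun s hs => ?_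
  rw [Set.uIcc_of_le ht] at hs
  simp only [hk s hs.1]

lemma emaHat_congr {c t : ℝ} (ht : 0 ≤ t) {h k : ℝ → ℝ} (hk : ∀ s, 0 ≤ s → h s = k s) :
    emaHat c h t = emaHat c k t := by
  rw [emaHat, emaHat, ema_congr ht hk]

lemma ema_le_of_le {c t B : ℝ} (hc : 0 < c) (ht : 0 ≤ t) (hB : 0 ≤ B) {h : ℝ → ℝ}
    (hh : Continuous h) (hle : ∀ s, 0 ≤ s → h s ≤ B) : ema c h t ≤ B := by
  have h1 : ema c h t ≤ ema c (fun _ => B) t := by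
    refine intervalIntegral.integral_mono_on ht
      ((continuous_ema_kernel hh c t).intervalIntegrable _ _)
      ((continuous_ema_kernel continuous_const c t).intervalIntegrable _ _) fun s hs => ?_
    exact mul_le_mul_of_nonneg_left (hle s hs.1) (by positivity)
  rw [ema_const] at h1
  nlinarith [Real.exp_pos (-c * t)]

lemma one_sub_exp_pos {c t : ℝ} (hc : 0 < c) (ht : 0 < t) : 0 < 1 - Real.exp (-c * t) := by
  rw [sub_pos, Real.exp_lt_one_iff]
  nlinarith

lemma ema_sub_const {h : ℝ → ℝ} (hh : Continuous h) (c a t : ℝ) :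
    ema c (fun s => h s - a) t = ema c h t - a * (1 - Real.exp (-c * t)) := by
  rw [← ema_const, ema, ema, ema, ← intervalIntegral.integral_sub
    ((continuous_ema_kernel hh c t).intervalIntegrable _ _)
    ((continuous_ema_kernel continuous_const c t).intervalIntegrable _ _)]
  exact intervalIntegral.integral_congr fun s _ => by ring

/-- Jensen's inequality for the bias-corrected moving average. -/
lemma sq_emaHat_le {c t : ℝ} (hc : 0 < c) (ht : 0 < t) {h : ℝ → ℝ} (hh : Continuous h) :
    emaHat c h t ^ 2 ≤ emaHat c (fun s => h s ^ 2) t := by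
  have he := one_sub_exp_pos hc ht
  set a := emaHat c h t with ha
  have hema : ema c h t = a * (1 - Real.exp (-c * t)) := by
    rw [ha, emaHat, mul_comm _ (ema c h t), mul_assoc, inv_mul_cancel₀ he.ne', mul_one]
  -- The weighted variance of `h` about its own mean `a` is nonnegative.
  have h0 : 0 ≤ ema c (fun s => (h s - a) ^ 2) t :=
    intervalIntegral.integral_nonneg ht.le fun s _ => by positivity
  have hh2 : Continuous fun s => h s ^ 2 := hh.pow 2
  have h1 : ema c (fun s => (h s - a) ^ 2) t = ema c (fun s => h s ^ 2) t
      - 2 * a * ema c h t + a ^ 2 * (1 - Real.exp (-c * t)) := by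
    rw [← ema_const, ema, ema, ema, ema, ← intervalIntegral.integral_const_mul,
      ← intervalIntegral.integral_sub
        ((continuous_ema_kernel hh2 c t).intervalIntegrable _ _)
        (((continuous_ema_kernel hh c t).const_mul _).intervalIntegrable _ _),
      ← intervalIntegral.integral_add
        ((by fun_prop : Continuous fun s => c * Real.exp (-c * (t - s)) * h s ^ 2
          - 2 * a * (c * Real.exp (-c * (t - s)) * h s)).intervalIntegrable _ _)
        ((continuous_ema_kernel continuous_const c t).intervalIntegrable _ _)]
    exact intervalIntegral.integral_congr fun s _ => by ring
  rw [h1, hema] at h0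
  rw [emaHat, inv_mul_eq_div, le_div_iff₀ he]
  linarith

lemma ema_pos {c t : ℝ} (hc : 0 < c) (ht : 0 < t) {h : ℝ → ℝ} (hh : Continuous h)
    (hnn : ∀ s, 0 ≤ h s) (h0 : 0 < h 0) : 0 < ema c h t := by
  refine intervalIntegral.integral_pos ht (continuous_ema_kernel hh c t).continuousOn
    (fun s _ => mul_nonneg (by positivity) (hnn s)) ⟨0, ⟨le_rfl, ht.le⟩, by positivity⟩

/-- The factor `c₁ / c₂` equalizes the two kernels at `s = t`; at earlier times the one with the
slower rate `c₂` is larger, so the difference has a sign when `c₂ ≤ c₁`. -/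
lemma ema_comparison_eq {c₁ c₂ : ℝ} (hc₂ : 0 < c₂) {h : ℝ → ℝ} (hh : Continuous h) (t : ℝ) :
    c₁ / c₂ * ema c₂ h t - ema c₁ h t
      = ∫ s in (0 : ℝ)..t,
        c₁ * (Real.exp (-c₂ * (t - s)) - Real.exp (-c₁ * (t - s))) * h s := by
  rw [ema, ema, ← intervalIntegral.integral_const_mul, ← intervalIntegral.integral_sub
    (((continuous_ema_kernel hh c₂ t).const_mul _).intervalIntegrable _ _)
    ((continuous_ema_kernel hh c₁ t).intervalIntegrable _ _)]
  refine intervalIntegral.integral_congr fun s _ => ?_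
  field_simp

lemma ema_comparison {c₁ c₂ t : ℝ} (hc₂ : 0 < c₂) (hc : c₂ ≤ c₁) (ht : 0 ≤ t) {h : ℝ → ℝ}
    (hh : Continuous h) (hnn : ∀ s, 0 ≤ h s) : ema c₁ h t ≤ c₁ / c₂ * ema c₂ h t := by
  rw [← sub_nonneg, ema_comparison_eq hc₂ hh]
  refine intervalIntegral.integral_nonneg ht fun s hs => ?_
  have : Real.exp (-c₁ * (t - s)) ≤ Real.exp (-c₂ * (t - s)) :=
    Real.exp_le_exp.2 (by nlinarith [hs.2])
  exact mul_nonneg (mul_nonneg (hc₂.le.trans hc) (sub_nonneg.2 this)) (hnn s)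

lemma ema_comparison_pos {c₁ c₂ t : ℝ} (hc₂ : 0 < c₂) (hc : c₂ < c₁) (ht : 0 < t) {h : ℝ → ℝ}
    (hh : Continuous h) (hnn : ∀ s, 0 ≤ h s) (h0 : 0 < h 0) :
    0 < c₁ / c₂ * ema c₂ h t - ema c₁ h t := by
  rw [ema_comparison_eq hc₂ hh]
  have hc₁ : 0 < c₁ := hc₂.trans hc
  refine intervalIntegral.integral_pos ht (by fun_prop) (fun s hs => ?_)
    ⟨0, ⟨le_rfl, ht.le⟩, ?_⟩
  · have : Real.exp (-c₁ * (t - s)) ≤ Real.exp (-c₂ * (t - s)) :=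
      Real.exp_le_exp.2 (by nlinarith [hs.2])
    exact mul_nonneg (mul_nonneg hc₁.le (sub_nonneg.2 this)) (hnn s)
  · have : Real.exp (-c₁ * (t - 0)) < Real.exp (-c₂ * (t - 0)) :=
      Real.exp_lt_exp.2 (by nlinarith)
    exact mul_pos (mul_pos hc₁ (sub_pos.2 this)) h0

/-- The moving average with the faster rate exceeds the slower one by at most a relative factor
that is the derivative of a function bounded above. -/
lemma exists_ema_potential {c₁ c₂ : ℝ} (hc₂ : 0 < c₂) (hc : c₂ ≤ c₁) {h : ℝ → ℝ}
    (hh : Continuous h) (hnn : ∀ s, 0 ≤ h s) (h0 : 0 < h 0) {B : ℝ}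
    (hB : ∀ s, 0 ≤ s → h s ≤ B) :
    ∃ (Ψ Ψ' : ℝ → ℝ) (K : ℝ), (∀ t, 0 < t → HasDerivAt Ψ (Ψ' t) t) ∧
      ContinuousOn Ψ' (Set.Ioi 0) ∧ (∀ t, 0 < t → Ψ t ≤ K) ∧
      ∀ t, 0 < t → ema c₁ h t ≤ (1 + Ψ' t) * ema c₂ h t := by
  rcases hc.eq_or_lt with rfl | hlt
  · refine ⟨fun _ => 0, fun _ => 0, 0, fun t _ => hasDerivAt_const t 0, continuousOn_const,
      fun _ _ => le_rfl, fun t _ => ?_⟩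
    simp
  have hc₁ : 0 < c₁ := hc₂.trans hlt
  have hB0 : 0 < B := h0.trans_le (hB 0 le_rfl)
  -- In `Q'` the terms in `h t` cancel, leaving `c₁` times the difference of the two averages. Hence
  -- a multiple of `log Q` can serve as potential, and it is bounded above because `h` is.
  set Q : ℝ → ℝ := fun t => c₁ / c₂ * ema c₂ h t - ema c₁ h t with hQ
  have hQpos : ∀ t, 0 < t → 0 < Q t := fun t ht => ema_comparison_pos hc₂ hlt ht hh hnn h0
  set a : ℝ := c₁ / c₂ - 1 with ha
  have hapos : 0 < a := by rw [ha, sub_pos, lt_div_iff₀ hc₂]; linarith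
  have hQd : ∀ t, HasDerivAt Q (c₁ * (ema c₁ h t - ema c₂ h t)) t := by
    intro t
    refine (((hasDerivAt_ema hh c₂ t).const_mul (c₁ / c₂)).sub
      (hasDerivAt_ema hh c₁ t)).congr_deriv ?_
    field_simp
    ring
  have hQc : Continuous Q := continuous_iff_continuousAt.2 fun t => (hQd t).continuousAt
  refine ⟨fun t => a / c₁ * Real.log (Q t),
    fun t => a / c₁ * (c₁ * (ema c₁ h t - ema c₂ h t) / Q t),
    a / c₁ * Real.log (c₁ / c₂ * B), fun t ht => ?_, ?_, fun t ht => ?_, fun t ht => ?_⟩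
  · exact ((hQd t).log (hQpos t ht).ne').const_mul _
  · refine continuousOn_const.mul (ContinuousOn.div ?_ hQc.continuousOn
      fun t ht => (hQpos t ht).ne')
    exact (continuous_const.mul ((continuous_ema hh c₁).sub
      (continuous_ema hh c₂))).continuousOn
  · refine mul_le_mul_of_nonneg_left (Real.log_le_log (hQpos t ht) ?_) (by positivity)
    have h1 : 0 < ema c₁ h t := ema_pos hc₁ ht hh hnn h0
    have h2 : ema c₂ h t ≤ B := ema_le_of_le hc₂ ht.le hB0.le hh hB
    have h3 : c₁ / c₂ * ema c₂ h t ≤ c₁ / c₂ * B :=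
      mul_le_mul_of_nonneg_left h2 (by positivity)
    simp only [hQ]
    linarith
  · have hq := hQpos t ht
    have h1 : Q t = (1 + a) * ema c₂ h t - ema c₁ h t := by simp only [hQ, ha]; ring
    -- With `V₁`, `V₂` the two averages, `a * V₂ - Q = V₁ - V₂`; the constant `a / c₁` is chosen so
    -- that the defect becomes a perfect square over `Q`.
    have h2 : (1 + a / c₁ * (c₁ * (ema c₁ h t - ema c₂ h t) / Q t)) * ema c₂ h t - ema c₁ h t
        = (ema c₁ h t - ema c₂ h t) ^ 2 / Q t := by
      field_simp
      rw [h1]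
      ring
    rw [← sub_nonneg, h2]
    positivity

/-! ### Slowly varying functions -/

/-- `h` varies slowly relative to the scale `A`. -/
def SlowlyVarying (h A : ℝ → ℝ) : Prop :=
  ∀ δ, 0 < δ → ∃ T, 0 ≤ T ∧ ∀ s t, T ≤ s → s ≤ t →
    |h s - h t| ≤ δ * Real.exp (δ * (t - s)) * A t

/-- Factor `h s ^ 2 - h t ^ 2`; the sum `h s + h t` is controlled by `A t` because `A s` is itself
comparable to `A t` up to a small exponential. -/
lemma SlowlyVarying.sq {h A : ℝ → ℝ} (hh : SlowlyVarying h A) (hA : SlowlyVarying A A)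
    {T₀ K : ℝ} (hK : ∀ t, T₀ ≤ t → |h t| ≤ K * A t) (hApos : ∀ t, T₀ ≤ t → 0 < A t) :
    SlowlyVarying (fun t => h t ^ 2) (fun t => A t ^ 2) := by
  intro δ hδ
  have hK0 : 0 ≤ K := by
    have h1 := (abs_nonneg _).trans (hK T₀ le_rfl)
    exact nonneg_of_mul_nonneg_left h1 (hApos T₀ le_rfl)
  -- The two factors each carry `exp (ε * (t - s))`, whence `ε ≤ δ / 2`; the constant `3 * K` comes
  -- from the bound on `h s + h t`.
  set ε := min 1 (min (δ / 2) (δ / (3 * K + 1))) with hε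
  have hεpos : 0 < ε := by positivity
  have hε1 : ε ≤ 1 := min_le_left _ _
  have hε2 : ε ≤ δ / 2 := (min_le_right _ _).trans (min_le_left _ _)
  have hε3 : 3 * K * ε ≤ δ := by
    have h1 : ε ≤ δ / (3 * K + 1) := (min_le_right _ _).trans (min_le_right _ _)
    rw [le_div_iff₀ (by positivity)] at h1
    linarith
  obtain ⟨T₁, hT₁, h1⟩ := hh ε hεpos
  obtain ⟨T₂, hT₂, h2⟩ := hA ε hεpos
  refine ⟨max T₀ (max T₁ T₂), hT₁.trans ((le_max_left _ _).trans (le_max_right _ _)),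
    fun s t hs hst => ?_⟩
  have hs0 : T₀ ≤ s := (le_max_left _ _).trans hs
  have hs1 : T₁ ≤ s := ((le_max_left _ _).trans (le_max_right _ _)).trans hs
  have hs2 : T₂ ≤ s := ((le_max_right _ _).trans (le_max_right _ _)).trans hs
  have hAt := hApos t (hs0.trans hst)
  set e := Real.exp (ε * (t - s)) with he
  have he1 : 1 ≤ e := Real.one_le_exp (by nlinarith)
  have h3 : |h s - h t| ≤ ε * e * A t := h1 s t hs1 hst
  have h4 : A s ≤ 2 * e * A t := by
    have h5 := (abs_le.1 (h2 s t hs2 hst)).2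
    have h6 : ε * e * A t ≤ 1 * e * A t := by gcongr
    nlinarith
  have h5 : |h s + h t| ≤ 3 * K * e * A t := by
    have h6 := hK s hs0
    have h7 := hK t (hs0.trans hst)
    have h8 : K * A s ≤ K * (2 * e * A t) := mul_le_mul_of_nonneg_left h4 hK0
    have h9 : K * A t ≤ K * (e * A t) := mul_le_mul_of_nonneg_left (by nlinarith) hK0
    have := abs_add_le (h s) (h t)
    linarith
  have h6 : e * e ≤ Real.exp (δ * (t - s)) := by
    rw [he, ← Real.exp_add]
    exact Real.exp_le_exp.2 (by nlinarith)
  calc |h s ^ 2 - h t ^ 2| = |h s - h t| * |h s + h t| := by rw [← abs_mul]; ring_nf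
    _ ≤ (ε * e * A t) * (3 * K * e * A t) := by gcongr
    _ = (3 * K * ε) * (e * e) * A t ^ 2 := by ring
    _ ≤ δ * Real.exp (δ * (t - s)) * A t ^ 2 := by gcongr

/-- The bias-corrected moving average tracks a slowly varying function. -/
lemma SlowlyVarying.emaHat_sub_le {h A : ℝ → ℝ} (hh : SlowlyVarying h A)
    (hA : SlowlyVarying A A) (hcont : Continuous h) {T₀ : ℝ} (hApos : ∀ t, T₀ ≤ t → 0 < A t)
    {c : ℝ} (hc : 0 < c) {ε : ℝ} (hε : 0 < ε) :
    ∀ᶠ t in atTop, |emaHat c h t - h t| ≤ ε * A t := by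
  -- With `δ ≤ c / 2`, half of the kernel's decay absorbs the growth `exp (δ * (t - s))` and half
  -- remains integrable.
  set δ := min (c / 2) (min 1 (ε / 8)) with hδ
  have hδpos : 0 < δ := by positivity
  have hδc : δ ≤ c / 2 := min_le_left _ _
  have hδ1 : δ ≤ 1 := (min_le_right _ _).trans (min_le_left _ _)
  have hδε : δ ≤ ε / 8 := (min_le_right _ _).trans (min_le_right _ _)
  obtain ⟨T₁, hT₁, h1⟩ := hh δ hδpos
  obtain ⟨T₂, hT₂, h2⟩ := hA δ hδpos
  set T := max T₀ (max T₁ T₂) with hT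
  have hT0 : 0 ≤ T := hT₁.trans ((le_max_left _ _).trans (le_max_right _ _))
  have hTT₁ : T₁ ≤ T := (le_max_left _ _).trans (le_max_right _ _)
  have hTT₂ : T₂ ≤ T := (le_max_right _ _).trans (le_max_right _ _)
  have hAT : 0 < A T := hApos T (le_max_left _ _)
  obtain ⟨B, hB⟩ := isCompact_Icc.exists_bound_of_continuousOn (s := Set.Icc 0 T)
    hcont.continuousOn
  have hB0 : 0 ≤ B := (norm_nonneg _).trans (hB 0 ⟨le_rfl, hT0⟩)
  set D : ℝ := 4 * B / A T + 1 with hD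
  have hD0 : 0 ≤ D := by positivity
  -- For `s ≥ T` slow variation applies. For `s ≤ T`, `h` is bounded on a compact interval and `A t`
  -- is at least a constant times `exp (-δ * t)`. The extra factor `exp (c * (T - s)) ≥ 1` makes the
  -- product with the kernel independent of `s`.
  have hkey : ∀ s t, 0 ≤ s → s ≤ t → T ≤ t → |h s - h t| ≤
      A t * (δ * Real.exp (δ * (t - s)) + D * Real.exp (δ * t) * Real.exp (c * (T - s))) := by
    intro s t hs hst hTt
    have hAt : 0 < A t := hApos t ((le_max_left _ _).trans hTt)
    rcases le_total T s with hTs | hsT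
    · have h3 := h1 s t (hTT₁.trans hTs) hst
      have h4 : 0 ≤ A t * (D * Real.exp (δ * t) * Real.exp (c * (T - s))) := by positivity
      linarith
    · have h3 := h1 T t hTT₁ hTt
      have h4 : A T ≤ 2 * Real.exp (δ * t) * A t := by
        have h5 := (abs_le.1 (h2 T t hTT₂ hTt)).2
        have h6 : Real.exp (δ * (t - T)) ≤ Real.exp (δ * t) :=
          Real.exp_le_exp.2 (by nlinarith)
        have h7 : δ * Real.exp (δ * (t - T)) * A t ≤ 1 * Real.exp (δ * t) * A t := by gcongr
        have h8 : 1 ≤ Real.exp (δ * t) := Real.one_le_exp (by nlinarith)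
        nlinarith
      have h5 : |h s - h T| ≤ 2 * B := by
        have h6 := hB s ⟨hs, hsT⟩
        have h7 := hB T ⟨hT0, le_rfl⟩
        rw [Real.norm_eq_abs] at h6 h7
        have := abs_sub (h s) (h T)
        linarith
      have h6 : 2 * B ≤ (4 * B / A T) * (Real.exp (δ * t) * A t) := by
        have h7 : 2 * B = (2 * B / A T) * A T := by field_simp
        have h8 : (2 * B / A T) * A T ≤ (2 * B / A T) * (2 * Real.exp (δ * t) * A t) := by
          gcongr
        calc 2 * B ≤ (2 * B / A T) * (2 * Real.exp (δ * t) * A t) := h7.le.trans h8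
          _ = _ := by ring
      have h7 : δ * Real.exp (δ * (t - T)) * A t ≤ 1 * (Real.exp (δ * t) * A t) := by
        rw [mul_assoc]
        gcongr
        linarith
      have h8 : |h s - h t| ≤ D * Real.exp (δ * t) * A t := by
        have := abs_sub_le (h s) (h T) (h t)
        rw [hD]
        linarith
      have h9 : D * Real.exp (δ * t) * A t * 1
          ≤ D * Real.exp (δ * t) * A t * Real.exp (c * (T - s)) := by
        gcongr
        exact Real.one_le_exp (mul_nonneg hc.le (sub_nonneg.2 hsT))
      have h10 : 0 ≤ A t * (δ * Real.exp (δ * (t - s))) := by positivity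
      linarith
  have hint : ∀ t, 0 ≤ t → T ≤ t → |ema c (fun s => h s - h t) t| ≤
      A t * (2 * δ + c * D * Real.exp (c * T) * (t * Real.exp (-(c / 2) * t))) := by
    intro t ht hTt
    have hAt : 0 < A t := hApos t ((le_max_left _ _).trans hTt)
    -- The trailing factor `1` matches the integrand of `ema (c / 2)` at a constant function, which
    -- `ema_const` evaluates.
    have hcont1 : Continuous fun s => c / 2 * Real.exp (-(c / 2) * (t - s)) * (1 : ℝ) := by
      fun_prop
    have hbound : ∀ s ∈ Set.Ioc 0 t, ‖c * Real.exp (-c * (t - s)) * (h s - h t)‖ ≤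
        A t * (2 * δ * (c / 2 * Real.exp (-(c / 2) * (t - s)) * (1 : ℝ))
          + c * D * Real.exp (c * T) * Real.exp (-(c / 2) * t)) := by
      intro s hs
      rw [Real.norm_eq_abs, abs_mul, abs_of_nonneg (by positivity : 0 ≤ c * Real.exp (-c * (t - s)))]
      have h3 := mul_le_mul_of_nonneg_left (hkey s t hs.1.le hs.2 hTt)
        (by positivity : 0 ≤ c * Real.exp (-c * (t - s)))
      refine h3.trans ?_
      have e1 : Real.exp (-c * (t - s)) * Real.exp (δ * (t - s))
          ≤ Real.exp (-(c / 2) * (t - s)) := by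
        rw [← Real.exp_add]
        exact Real.exp_le_exp.2 (by nlinarith [hs.2])
      have e2 : Real.exp (-c * (t - s)) * (Real.exp (δ * t) * Real.exp (c * (T - s)))
          ≤ Real.exp (c * T) * Real.exp (-(c / 2) * t) := by
        rw [← Real.exp_add, ← Real.exp_add, ← Real.exp_add]
        exact Real.exp_le_exp.2 (by nlinarith)
      calc c * Real.exp (-c * (t - s)) * (A t * (δ * Real.exp (δ * (t - s))
            + D * Real.exp (δ * t) * Real.exp (c * (T - s))))
          = A t * (c * δ * (Real.exp (-c * (t - s)) * Real.exp (δ * (t - s)))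
            + c * D * (Real.exp (-c * (t - s)) *
              (Real.exp (δ * t) * Real.exp (c * (T - s))))) := by ring
        _ ≤ A t * (c * δ * Real.exp (-(c / 2) * (t - s))
            + c * D * (Real.exp (c * T) * Real.exp (-(c / 2) * t))) := by gcongr
        _ = _ := by ring
    have h3 := intervalIntegral.norm_integral_le_of_norm_le ht
      (Eventually.of_forall hbound)
      ((show Continuous fun s => A t * (2 * δ *
        (c / 2 * Real.exp (-(c / 2) * (t - s)) * (1 : ℝ))
          + c * D * Real.exp (c * T) * Real.exp (-(c / 2) * t)) by fun_prop).intervalIntegrable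
            (μ := volume) 0 t)
    rw [intervalIntegral.integral_const_mul, intervalIntegral.integral_add
      ((hcont1.const_mul _).intervalIntegrable _ _) (continuous_const.intervalIntegrable _ _),
      intervalIntegral.integral_const_mul, intervalIntegral.integral_const] at h3
    have h4 := ema_const (c / 2) 1 t
    rw [ema] at h4
    rw [h4] at h3
    refine h3.trans (mul_le_mul_of_nonneg_left ?_ hAt.le)
    simp only [sub_zero, smul_eq_mul]
    nlinarith [Real.exp_pos (-(c / 2) * t)]
  have hlim1 : Tendsto (fun t => c * D * Real.exp (c * T) * (t * Real.exp (-(c / 2) * t))) atTop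
      (𝓝 0) := by
    have h3 := tendsto_rpow_mul_exp_neg_mul_atTop_nhds_zero 1 (c / 2) (by positivity)
    simp only [Real.rpow_one] at h3
    simpa using h3.const_mul (c * D * Real.exp (c * T))
  have hlim2 : Tendsto (fun t => Real.exp (-c * t)) atTop (𝓝 0) :=
    Real.tendsto_exp_atBot.comp (tendsto_id.const_mul_atTop_of_neg (neg_lt_zero.2 hc))
  filter_upwards [hlim1.eventually_lt_const (by positivity : 0 < ε / 4),
    hlim2.eventually_lt_const (by norm_num : (0 : ℝ) < 1 / 2), eventually_ge_atTop T] with t h3 h4 h5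
  have hAt : 0 < A t := hApos t ((le_max_left _ _).trans h5)
  have he : 1 / 2 ≤ 1 - Real.exp (-c * t) := by linarith
  have he0 : 0 < 1 - Real.exp (-c * t) := by linarith
  have h6 : emaHat c h t - h t = (1 - Real.exp (-c * t))⁻¹ * ema c (fun s => h s - h t) t := by
    rw [ema_sub_const hcont, emaHat, mul_sub, mul_comm (h t), ← mul_assoc,
      inv_mul_cancel₀ he0.ne', one_mul]
  rw [h6, abs_mul, abs_of_pos (inv_pos.2 he0), inv_mul_eq_div, div_le_iff₀ he0]
  calc |ema c (fun s => h s - h t) t|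
      ≤ A t * (2 * δ + c * D * Real.exp (c * T) * (t * Real.exp (-(c / 2) * t))) :=
        hint t (hT0.trans h5) h5
    _ ≤ A t * (ε / 2) := mul_le_mul_of_nonneg_left (by linarith) hAt.le
    _ ≤ ε * A t * (1 - Real.exp (-c * t)) := by nlinarith [mul_pos hε hAt]

/-- A positive function whose logarithm is asymptotically Lipschitz with arbitrarily small constant
is slowly varying. -/
lemma slowlyVarying_of_log {b : ℝ → ℝ} {T₀ : ℝ} (hb : ∀ t, T₀ ≤ t → 0 < b t)
    (hlog : ∀ δ, 0 < δ → ∃ T, 0 ≤ T ∧ ∀ s t, T ≤ s → s ≤ t →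
      |Real.log (b s) - Real.log (b t)| ≤ δ * (t - s)) : SlowlyVarying b b := by
  intro δ hδ
  -- Arranged so that `ε * r * exp (ε * r) ≤ δ * exp (δ * r)`: the linear factor `r` and the
  -- exponential each cost at most `exp (δ / 2 * r)`.
  set ε := δ * min (1 / 2) (δ / 2) with hε
  have hεpos : 0 < ε := by positivity
  obtain ⟨T, hT, h⟩ := hlog ε hεpos
  refine ⟨max T₀ T, hT.trans (le_max_right _ _), fun s t hs hst => ?_⟩
  have hbs := hb s ((le_max_left _ _).trans hs)
  have hbt := hb t (((le_max_left _ _).trans hs).trans hst)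
  have h1 := h s t ((le_max_right _ _).trans hs) hst
  set r := t - s with hr
  have hr0 : 0 ≤ r := sub_nonneg.2 hst
  set z := Real.log (b s) - Real.log (b t) with hz
  have h2 : b s = b t * Real.exp z := by
    rw [hz, Real.exp_sub, Real.exp_log hbs, Real.exp_log hbt]; field_simp
  have h3 : |Real.exp z - 1| ≤ ε * r * Real.exp (ε * r) := by
    obtain ⟨hz1, hz2⟩ := abs_le.1 h1
    have hx : 0 ≤ ε * r := by positivity
    have h4 : 1 ≤ Real.exp (ε * r) := Real.one_le_exp hx
    rw [abs_le]
    constructor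
    · nlinarith [Real.add_one_le_exp z]
    · have h5 : Real.exp z ≤ Real.exp (ε * r) := Real.exp_le_exp.2 hz2
      have h6 : 1 - ε * r ≤ Real.exp (-(ε * r)) := by
        linarith [Real.add_one_le_exp (-(ε * r))]
      have h7 : Real.exp (-(ε * r)) * Real.exp (ε * r) = 1 := by
        rw [← Real.exp_add]; simp
      nlinarith [Real.exp_pos (ε * r)]
  have h4 : ε * r * Real.exp (ε * r) ≤ δ * Real.exp (δ * r) := by
    have h5 : min (1 / 2) (δ / 2) * r ≤ Real.exp (δ / 2 * r) := by
      have h6 : min (1 / 2) (δ / 2) * r ≤ δ / 2 * r :=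
        mul_le_mul_of_nonneg_right (min_le_right _ _) hr0
      linarith [Real.add_one_le_exp (δ / 2 * r)]
    have h6 : Real.exp (ε * r) ≤ Real.exp (δ / 2 * r) := by
      refine Real.exp_le_exp.2 (mul_le_mul_of_nonneg_right ?_ hr0)
      have : min (1 / 2) (δ / 2) ≤ 1 / 2 := min_le_left _ _
      rw [hε]; nlinarith
    have h7 : Real.exp (δ * r) = Real.exp (δ / 2 * r) * Real.exp (δ / 2 * r) := by
      rw [← Real.exp_add]; ring_nf
    calc ε * r * Real.exp (ε * r) = δ * (min (1 / 2) (δ / 2) * r * Real.exp (ε * r)) := by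
          rw [hε]; ring
      _ ≤ δ * (Real.exp (δ / 2 * r) * Real.exp (δ / 2 * r)) := by gcongr
      _ = _ := by rw [h7]
  rw [h2, show b t * Real.exp z - b t = (Real.exp z - 1) * b t by ring, abs_mul, abs_of_pos hbt]
  exact mul_le_mul_of_nonneg_right (h3.trans h4) hbt.le

/-! ### Integration against a monotone weight -/

/-- One step of a discrete integration by parts: the weight is frozen at the left endpoint, and the
right-hand side is shaped to telescope over a subdivision. -/
lemma integral_antitone_mul_deriv_le_add {η h h' : ℝ → ℝ} {a b B K : ℝ} (hη : AntitoneOn η (Set.Icc a b))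
    (hd : ∀ x ∈ Set.Icc a b, HasDerivAt h (h' x) x) (hc : ContinuousOn h' (Set.Icc a b))
    (hB : ∀ x ∈ Set.Icc a b, h x ≤ B) (hK : ∀ x ∈ Set.Icc a b, |h' x| ≤ K)
    {s t : ℝ} (has : a ≤ s) (hst : s ≤ t) (htb : t ≤ b) :
    ∫ x in s..t, η x * h' x ≤
      η s * (B - h s) - η t * (B - h t) + K * (t - s) * (η s - η t) := by
  have hsub : Set.Icc s t ⊆ Set.Icc a b := Set.Icc_subset_Icc has htb
  have hsub' : Set.uIcc s t ⊆ Set.Icc a b := by rwa [Set.uIcc_of_le hst]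
  have hηi : IntervalIntegrable η volume s t := (hη.mono hsub').intervalIntegrable
  have hci : ContinuousOn h' (Set.uIcc s t) := hc.mono hsub'
  have hηst : η t ≤ η s := hη (hsub ⟨le_rfl, hst⟩) (hsub ⟨hst, le_rfl⟩) hst
  have h1 : ∫ x in s..t, (η x - η s) * h' x ≤ K * (t - s) * (η s - η t) := by
    have h2 : ∀ x ∈ Set.uIoc s t, ‖(η x - η s) * h' x‖ ≤ (η s - η t) * K := by
      intro x hx
      rw [Set.uIoc_of_le hst] at hx
      have hx' : x ∈ Set.Icc a b := hsub ⟨hx.1.le, hx.2⟩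
      have h3 := hη (hsub ⟨le_rfl, hst⟩) hx' hx.1.le
      have h4 := hη hx' (hsub ⟨hst, le_rfl⟩) hx.2
      rw [norm_mul, Real.norm_eq_abs, Real.norm_eq_abs]
      have h5 : |η x - η s| ≤ η s - η t := by rw [abs_le]; constructor <;> linarith
      exact mul_le_mul h5 (hK x hx') (abs_nonneg _) (by linarith)
    have h3 := intervalIntegral.norm_integral_le_of_norm_le_const h2
    rw [abs_of_nonneg (sub_nonneg.2 hst)] at h3
    calc _ ≤ _ := le_abs_self _
      _ ≤ _ := h3
      _ = _ := by ring
  have h2 : ∫ x in s..t, η s * h' x = η s * (h t - h s) := by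
    rw [intervalIntegral.integral_const_mul, intervalIntegral.integral_eq_sub_of_hasDerivAt
      (fun x hx => hd x (hsub' hx)) hci.intervalIntegrable]
  have h3 : ∫ x in s..t, η x * h' x
      = (∫ x in s..t, (η x - η s) * h' x) + ∫ x in s..t, η s * h' x := by
    rw [← intervalIntegral.integral_add]
    · exact intervalIntegral.integral_congr fun x _ => by ring
    · exact (hηi.sub intervalIntegrable_const).mul_continuousOn hci
    · exact hci.intervalIntegrable.const_mul _
  have h4 := hB t (hsub ⟨hst, le_rfl⟩)
  rw [h3, h2]
  nlinarith

/-- A form of the second mean value theorem: the integral of `h'` against a nonincreasing weight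
is controlled by an upper bound of `h`. -/
lemma integral_antitone_mul_deriv_le {η h h' : ℝ → ℝ} {a b B : ℝ} (hab : a ≤ b)
    (hη : AntitoneOn η (Set.Icc a b)) (hηb : 0 ≤ η b)
    (hd : ∀ x ∈ Set.Icc a b, HasDerivAt h (h' x) x) (hc : ContinuousOn h' (Set.Icc a b))
    (hB : ∀ x ∈ Set.Icc a b, h x ≤ B) :
    ∫ x in a..b, η x * h' x ≤ η a * (B - h a) := by
  obtain ⟨K, hK⟩ := isCompact_Icc.exists_bound_of_continuousOn hc
  have hint : ∀ s t, s ∈ Set.Icc a b → t ∈ Set.Icc a b →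
      IntervalIntegrable (fun x => η x * h' x) volume s t := by
    intro s t hs ht
    have hsub : Set.uIcc s t ⊆ Set.Icc a b := Set.uIcc_subset_Icc hs ht
    exact (hη.mono hsub).intervalIntegrable.mul_continuousOn (hc.mono hsub)
  -- On a uniform mesh the freezing errors telescope to the mesh size times the total drop of `η`,
  -- which vanishes as `n → ∞`. Only monotonicity of `η` is needed.
  have hstep : ∀ (n : ℕ), 0 < n → ∀ k : ℕ, k ≤ n →
      ∫ x in a..(a + k * ((b - a) / n)), η x * h' x ≤
        η a * (B - h a) - η (a + k * ((b - a) / n)) * (B - h (a + k * ((b - a) / n)))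
          + K * ((b - a) / n) * (η a - η (a + k * ((b - a) / n))) := by
    intro n hn k hk
    have hn' : (0 : ℝ) < n := Nat.cast_pos.2 hn
    have hΔ : 0 ≤ (b - a) / n := div_nonneg (sub_nonneg.2 hab) hn'.le
    have hmem : ∀ k : ℕ, k ≤ n → a + k * ((b - a) / n) ∈ Set.Icc a b := by
      intro k hk
      have h1 : (k : ℝ) ≤ n := Nat.cast_le.2 hk
      have h2 : (n : ℝ) * ((b - a) / n) = b - a := by field_simp
      have h3 := mul_le_mul_of_nonneg_right h1 hΔ
      exact ⟨le_add_of_nonneg_right (by positivity), by linarith⟩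
    induction k with
    | zero => simp
    | succ k ih =>
      have ih := ih (by omega)
      have hs := hmem k (by omega)
      have ht := hmem (k + 1) hk
      have hst : a + k * ((b - a) / n) ≤ a + ((k + 1 : ℕ) : ℝ) * ((b - a) / n) := by
        push_cast; nlinarith
      have h1 := integral_antitone_mul_deriv_le_add hη hd hc hB hK hs.1 hst ht.2
      have h2 : a + ((k + 1 : ℕ) : ℝ) * ((b - a) / n) - (a + k * ((b - a) / n)) = (b - a) / n := by
        push_cast; ring
      rw [h2] at h1
      rw [← intervalIntegral.integral_add_adjacent_intervals
        (hint a _ ⟨le_rfl, hab⟩ hs) (hint _ _ hs ht)]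
      linarith
  have hmain : ∀ n : ℕ, ∫ x in a..b, η x * h' x ≤
      η a * (B - h a) + K * (b - a) * (η a - η b) * (1 / ((n : ℝ) + 1)) := by
    intro n
    have h1 := hstep (n + 1) n.succ_pos (n + 1) le_rfl
    have h2 : a + ((n + 1 : ℕ) : ℝ) * ((b - a) / ((n + 1 : ℕ) : ℝ)) = b := by
      have : ((n + 1 : ℕ) : ℝ) ≠ 0 := by positivity
      field_simp; ring
    rw [h2] at h1
    have h3 : 0 ≤ η b * (B - h b) := mul_nonneg hηb (sub_nonneg.2 (hB b ⟨hab, le_rfl⟩))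
    have h4 : K * ((b - a) / ((n + 1 : ℕ) : ℝ)) * (η a - η b)
        = K * (b - a) * (η a - η b) * (1 / ((n : ℝ) + 1)) := by push_cast; ring
    linarith
  have hlim : Tendsto (fun n : ℕ => η a * (B - h a)
      + K * (b - a) * (η a - η b) * (1 / ((n : ℝ) + 1))) atTop (𝓝 (η a * (B - h a))) := by
    simpa using (tendsto_one_div_add_atTop_nhds_zero_nat (𝕜 := ℝ)).const_mul
      (K * (b - a) * (η a - η b)) |>.const_add (η a * (B - h a))
  exact ge_of_tendsto' hlim hmain

/-! ### Arcs driven by a monotone step size -/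

lemma IsArc.continuousOn {p : ℕ} {θ : ℝ → Fin p → ℝ} (h : IsArc θ) :
    ContinuousOn θ (Set.Ici 0) := by
  obtain ⟨θ', hθ⟩ := h
  intro t ht
  have h1 : ContinuousOn (fun t => θ 0 + ∫ s in (0 : ℝ)..t, θ' s) (Set.Icc 0 (t + 1)) := by
    have ht1 : (0 : ℝ) ≤ t + 1 := by have : (0 : ℝ) ≤ t := ht; linarith
    have h2 := intervalIntegral.continuousOn_primitive_interval' (hθ (t + 1) ht1).1
      Set.left_mem_uIcc
    rw [Set.uIcc_of_le ht1] at h2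
    exact continuousOn_const.add h2
  have h2 : ContinuousOn θ (Set.Icc 0 (t + 1)) := h1.congr fun s hs => (hθ s hs.1).2
  refine (h2 t ⟨ht, by linarith⟩).mono_of_mem_nhdsWithin ?_
  exact mem_nhdsWithin.2 ⟨Set.Iio (t + 1), isOpen_Iio, by simp, fun s hs => ⟨hs.2, hs.1.le⟩⟩

lemma IsArc.ae_hasDerivAt {p : ℕ} {θ : ℝ → Fin p → ℝ} {θ' : ℝ → Fin p → ℝ}
    (hθ : ∀ t, 0 ≤ t → IntervalIntegrable θ' volume 0 t ∧ θ t = θ 0 + ∫ s in (0 : ℝ)..t, θ' s) :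
    ∀ᵐ t, 0 < t → HasDerivAt θ (θ' t) t := by
  have h1 : ∀ n : ℕ, ∀ᵐ t, t ∈ Set.uIcc (0 : ℝ) n → ∀ c ∈ Set.uIcc (0 : ℝ) n,
      HasDerivAt (fun x => ∫ s in c..x, θ' s) (θ' t) t := fun n =>
    IntervalIntegrable.ae_hasDerivAt_integral (hθ n n.cast_nonneg).1
  filter_upwards [ae_all_iff.2 h1] with t ht htpos
  obtain ⟨n, hn⟩ := exists_nat_ge t
  have h2 := ht n (by rw [Set.uIcc_of_le n.cast_nonneg]; exact ⟨htpos.le, hn⟩) 0 Set.left_mem_uIcc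
  refine (h2.const_add (θ 0)).congr_of_eventuallyEq ?_
  filter_upwards [lt_mem_nhds htpos] with s hs using (hθ s hs.le).2

lemma intervalIntegrable_antitone_smul {p : ℕ} {η : ℝ → ℝ} (hη : AntitoneOn η (Set.Ici 0))
    {U : ℝ → Fin p → ℝ} (hU : ContinuousOn U (Set.Ioi 0)) {a b : ℝ} (ha : 0 < a) (hb : 0 < b) :
    IntervalIntegrable (fun t => -η t • U t) volume a b := by
  have hsub : Set.uIcc a b ⊆ Set.Ioi 0 := fun x hx => (lt_min ha hb).trans_le hx.1
  have h1 : IntervalIntegrable η volume a b :=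
    (hη.mono fun x hx => Set.Ioi_subset_Ici_self (hsub hx)).intervalIntegrable
  exact h1.neg.smul_continuousOn (hU.mono hsub)

/-- An arc whose velocity is a.e. the product of a monotone step size and a continuous direction is
differentiable off a countable set. -/
lemma IsArc.exists_countable_hasDerivAt {p : ℕ} {θ : ℝ → Fin p → ℝ} (harc : IsArc θ) {η : ℝ → ℝ}
    (hη : AntitoneOn η (Set.Ici 0)) {U : ℝ → Fin p → ℝ} (hU : ContinuousOn U (Set.Ioi 0))
    (hode : ∀ᵐ t ∂(volume.restrict (Set.Ici (0 : ℝ))), HasDerivAt θ (-η t • U t) t) :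
    ∃ N : Set ℝ, N.Countable ∧ ∀ t, 0 < t → t ∉ N → HasDerivAt θ (-η t • U t) t := by
  obtain ⟨θ', hθ⟩ := harc
  have hae : ∀ᵐ t, 0 < t → θ' t = -η t • U t := by
    rw [ae_restrict_iff' measurableSet_Ici] at hode
    filter_upwards [hode, IsArc.ae_hasDerivAt hθ] with t h1 h2 ht
    exact (h2 ht).unique (h1 ht.le)
  have hint := fun {a b : ℝ} => intervalIntegrable_antitone_smul hη hU (a := a) (b := b)
  -- The exceptional set consists of the discontinuities of the monotone function `η`; elsewhere the
  -- integrand is continuous and the integral is differentiable.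
  refine ⟨{t ∈ Set.Ici 0 | ¬ContinuousWithinAt η (Set.Ici 0) t},
    hη.countable_not_continuousWithinAt, fun t ht htN => ?_⟩
  have hηt : ContinuousAt η t := by
    have h1 : ContinuousWithinAt η (Set.Ici 0) t := by
      by_contra h; exact htN ⟨ht.le, h⟩
    exact h1.continuousAt (Ici_mem_nhds ht)
  have hUt : ContinuousAt U t := hU.continuousAt (Ioi_mem_nhds ht)
  have ha : 0 < t / 2 := by positivity
  have hmeas : StronglyMeasurableAtFilter (fun t => -η t • U t) (𝓝 t) volume :=
    ⟨Set.Ioc (t / 2) (t + 1), Ioc_mem_nhds (by linarith) (by linarith),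
      (hint ha (b := t + 1) (by linarith)).1.1⟩
  have h1 : HasDerivAt (fun x => ∫ s in (t / 2)..x, -η s • U s) (-η t • U t) t :=
    intervalIntegral.integral_hasDerivAt_right (hint ha ht) hmeas (hηt.neg.smul hUt)
  refine (h1.const_add (θ (t / 2))).congr_of_eventuallyEq ?_
  filter_upwards [lt_mem_nhds (by linarith : t / 2 < t)] with s hs
  have hs0 : 0 < s := ha.trans hs
  rw [(hθ s hs0.le).2, (hθ (t / 2) ha.le).2, add_assoc]
  congr 1
  rw [← intervalIntegral.integral_add_adjacent_intervals (hθ (t / 2) ha.le).1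
    ((hθ (t / 2) ha.le).1.symm.trans (hθ s hs0.le).1)]
  congr 1
  refine intervalIntegral.integral_congr_ae ?_
  filter_upwards [hae] with r hr hrs
  rw [Set.uIoc_of_le hs.le] at hrs
  exact hr (ha.trans hrs.1)

/-- The fundamental theorem of calculus for a `C¹` function along such an arc. -/
lemma integral_gradVec_along_arc {p : ℕ} {θ : ℝ → Fin p → ℝ} {η : ℝ → ℝ}
    (hη : AntitoneOn η (Set.Ici 0)) {U : ℝ → Fin p → ℝ} (hU : ContinuousOn U (Set.Ioi 0))
    (hθ : ContinuousOn θ (Set.Ici 0)) {N : Set ℝ} (hN : N.Countable)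
    (hd : ∀ t, 0 < t → t ∉ N → HasDerivAt θ (-η t • U t) t) {F : (Fin p → ℝ) → ℝ} {a b : ℝ}
    (ha : 0 < a) (hab : a ≤ b) (hF : ∀ t ∈ Set.Icc a b, ContDiffAt ℝ 1 F (θ t)) :
    IntervalIntegrable (fun t => η t * ∑ j, U t j * gradVec F (θ t) j) volume a b ∧
      F (θ b) - F (θ a) = -∫ t in a..b, η t * ∑ j, U t j * gradVec F (θ t) j := by
  have hsub : Set.Icc a b ⊆ Set.Ioi 0 := fun x hx => ha.trans_le hx.1
  have hsub' : Set.Icc a b ⊆ Set.Ici 0 := fun x hx => Set.Ioi_subset_Ici_self (hsub hx)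
  have hg : ∀ j, ContinuousOn (fun t => gradVec F (θ t) j) (Set.Icc a b) := by
    intro j t ht
    have h1 : ContinuousAt (fun ϑ => gradVec F ϑ j) (θ t) := by
      have h2 : ContinuousAt (fderiv ℝ F) (θ t) :=
        (hF t ht).fderiv_right (m := 0) (by norm_num) |>.continuousAt
      exact h2.clm_apply continuousAt_const
    exact h1.comp_continuousWithinAt ((hθ t (hsub' ht)).mono hsub')
  have hsum : ContinuousOn (fun t => ∑ j, U t j * gradVec F (θ t) j) (Set.Icc a b) :=
    continuousOn_finsetSum _ fun j _ =>
      ((continuousOn_pi.1 (hU.mono hsub)) j).mul (hg j)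
  have hηi : IntervalIntegrable η volume a b :=
    (hη.mono (by rwa [Set.uIcc_of_le hab])).intervalIntegrable
  have hi : IntervalIntegrable (fun t => η t * ∑ j, U t j * gradVec F (θ t) j) volume a b :=
    hηi.mul_continuousOn (by rwa [Set.uIcc_of_le hab])
  refine ⟨hi, ?_⟩
  rw [← intervalIntegral.integral_neg]
  symm
  -- Countability of the exceptional set, rather than nullity, lets continuity of `F ∘ θ` suffice
  -- here.
  refine integral_eq_of_hasDerivAt_off_countable_of_le (fun t => F (θ t)) _ hab hN ?_ ?_ hi.neg
  · intro t ht
    exact (hF t ht).continuousAt.comp_continuousWithinAt ((hθ t (hsub' ht)).mono hsub')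
  · rintro t ⟨ht, htN⟩
    have h1 := ((hF t ⟨ht.1.le, ht.2.le⟩).differentiableAt one_ne_zero).hasFDerivAt.comp_hasDerivAt
      t (hd t (ha.trans ht.1) htN)
    refine h1.congr_deriv ?_
    rw [map_smul, fderiv_apply_eq_sum, smul_eq_mul]
    simp

/-! ### Loss exponents -/

namespace IsLossExponent

variable {φ : ℝ → ℝ} (h : IsLossExponent φ)

lemma exists_lipschitz_of_deriv_bdd {ψ : ℝ → ℝ} (hd : Differentiable ℝ ψ) {s : Set ℝ}
    (hs : Convex ℝ s) {M : ℝ} (hM : ∀ u ∈ s, |deriv ψ u| ≤ M) {a b : ℝ} (ha : a ∈ s)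
    (hb : b ∈ s) : |ψ a - ψ b| ≤ M * |a - b| :=
  Convex.norm_image_sub_le_of_norm_deriv_le (fun x _ => hd x) hM hs hb ha

include h

lemma differentiable : Differentiable ℝ φ := h.contDiff.differentiable two_ne_zero

lemma contDiff_deriv : ContDiff ℝ 1 (deriv φ) :=
  ((contDiff_succ_iff_deriv (n := 1)).1 (by simpa [one_add_one_eq_two] using h.contDiff)).2.2

lemma monotone_deriv : Monotone (deriv φ) :=
  monotone_of_deriv_nonneg (h.contDiff_deriv.differentiable one_ne_zero) h.deriv2_nonneg

lemma bddAbove : BddAbove (Set.range (deriv φ)) := by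
  obtain ⟨M, hM⟩ := h.deriv_bdd
  exact ⟨M, by rintro _ ⟨u, rfl⟩; exact hM u⟩

lemma deriv_le_iSup (u : ℝ) : deriv φ u ≤ ⨆ v, deriv φ v := le_ciSup h.bddAbove u

lemma iSup_pos : 0 < ⨆ v, deriv φ v := (h.deriv_pos 0).trans_le (h.deriv_le_iSup 0)

lemma abs_sub_le (a b : ℝ) : |φ a - φ b| ≤ (⨆ v, deriv φ v) * |a - b| :=
  exists_lipschitz_of_deriv_bdd h.differentiable convex_univ
    (fun u _ => by rw [abs_of_pos (h.deriv_pos u)]; exact h.deriv_le_iSup u) (Set.mem_univ a)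
    (Set.mem_univ b)

lemma le_add_mul {q : ℝ} (hq : 0 ≤ q) : φ q ≤ φ 0 + (⨆ v, deriv φ v) * q := by
  have h1 := (abs_le.1 (h.abs_sub_le q 0)).2
  rw [sub_zero, abs_of_nonneg hq] at h1
  linarith

/-- `φ` is convex, hence lies above its tangent at `0`. -/
lemma add_mul_le {q : ℝ} (hq : 0 ≤ q) : φ 0 + deriv φ 0 * q ≤ φ q := by
  have h1 : ConvexOn ℝ Set.univ φ :=
    MonotoneOn.convexOn_of_deriv convex_univ h.differentiable.continuous.continuousOn
      h.differentiable.differentiableOn (h.monotone_deriv.monotoneOn _)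
  rcases hq.eq_or_lt with rfl | hq
  · simp
  have h2 := h1.le_slope_of_hasDerivAt (Set.mem_univ 0) (Set.mem_univ q) hq
    (h.differentiable 0).hasDerivAt
  rw [slope_def_field, le_div_iff₀ (by linarith)] at h2
  linarith

/-- The derivative of `log φ'` is `φ'' / φ'`, and on `[0, ∞)` the denominator is at least `φ' 0`. -/
lemma exists_abs_log_sub_le : ∃ K, 0 ≤ K ∧ ∀ a b, 0 ≤ a → 0 ≤ b →
    |Real.log (deriv φ a) - Real.log (deriv φ b)| ≤ K * |a - b| := by
  obtain ⟨M, hM⟩ := h.deriv2_bdd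
  have hM0 : 0 ≤ M := (h.deriv2_nonneg 0).trans (hM 0)
  have h0 := h.deriv_pos 0
  have hd := h.contDiff_deriv.differentiable one_ne_zero
  refine ⟨M / deriv φ 0, by positivity, fun a b ha hb => ?_⟩
  refine exists_lipschitz_of_deriv_bdd (ψ := fun u => Real.log (deriv φ u)) (s := Set.Ici 0)
    (hd.log fun u => (h.deriv_pos u).ne') (convex_Ici 0) (fun u hu => ?_) ha hb
  rw [deriv.log (hd u) (h.deriv_pos u).ne', abs_of_nonneg
    (div_nonneg (h.deriv2_nonneg u) (h.deriv_pos u).le)]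
  exact div_le_div₀ hM0 (hM u) h0 (h.monotone_deriv hu)

lemma exists_le_deriv {δ : ℝ} (hδ : 0 < δ) :
    ∃ q₀, ∀ q, q₀ ≤ q → (1 - δ) * (⨆ v, deriv φ v) ≤ deriv φ q := by
  have h1 : (1 - δ) * (⨆ v, deriv φ v) < ⨆ v, deriv φ v := by nlinarith [h.iSup_pos]
  obtain ⟨q₀, hq₀⟩ := exists_lt_of_lt_ciSup h1
  exact ⟨q₀, fun q hq => hq₀.le.trans (h.monotone_deriv hq)⟩

end IsLossExponent

/-! ### The exponential-type loss of a family of functions -/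

/-- The loss `∑ i, exp (-φ (F i θ))` of a family `F` of margins. -/
noncomputable def expLoss {p m : ℕ} (φ : ℝ → ℝ) (F : Fin m → (Fin p → ℝ) → ℝ)
    (θ : Fin p → ℝ) : ℝ :=
  ∑ i, Real.exp (-φ (F i θ))

/-- The weight of the `i`-th gradient in the gradient of the loss. -/
noncomputable def lossWeight {p m : ℕ} (φ : ℝ → ℝ) (F : Fin m → (Fin p → ℝ) → ℝ)
    (θ : Fin p → ℝ) (i : Fin m) : ℝ :=
  Real.exp (-φ (F i θ)) * deriv φ (F i θ)

section expLoss

variable {p m : ℕ} {φ : ℝ → ℝ} {F : Fin m → (Fin p → ℝ) → ℝ}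

lemma contDiff_expLoss (hφ : IsLossExponent φ) (hF : ∀ i, ContDiff ℝ 1 (F i)) :
    ContDiff ℝ 1 (expLoss φ F) :=
  ContDiff.sum fun i _ => (((hφ.contDiff.of_le one_le_two).comp (hF i)).neg).exp

lemma expLoss_pos [NeZero m] (θ : Fin p → ℝ) : 0 < expLoss φ F θ :=
  Finset.sum_pos (fun _ _ => Real.exp_pos _) ⟨0, Finset.mem_univ _⟩

lemma gradVec_expLoss (hφ : IsLossExponent φ) (hF : ∀ i, ContDiff ℝ 1 (F i)) (θ : Fin p → ℝ)
    (j : Fin p) :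
    gradVec (expLoss φ F) θ j = -∑ i, lossWeight φ F θ i * gradVec (F i) θ j := by
  have h1 : HasFDerivAt (expLoss φ F)
      (∑ i, (-(Real.exp (-φ (F i θ)) * deriv φ (F i θ))) • fderiv ℝ (F i) θ) θ := by
    refine HasFDerivAt.fun_sum fun i _ => ?_
    have h2 := ((hφ.differentiable (F i θ)).hasDerivAt.neg).exp
    have h3 := h2.comp_hasFDerivAt θ ((hF i).differentiable one_ne_zero θ).hasFDerivAt
    refine h3.congr_fderiv ?_
    congr 1
    simp
  rw [gradVec, h1.fderiv, ← Finset.sum_neg_distrib, sum_apply]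
  refine Finset.sum_congr rfl fun i _ => ?_
  simp [lossWeight, gradVec]

lemma gradVec_comp {G : (Fin p → ℝ) → ℝ} {θ : Fin p → ℝ} {ψ : ℝ → ℝ} {ψ' : ℝ}
    (hψ : HasDerivAt ψ ψ' (G θ)) (hG : DifferentiableAt ℝ G θ) (j : Fin p) :
    gradVec (fun ϑ => ψ (G ϑ)) θ j = ψ' * gradVec G θ j := by
  have h1 := hψ.comp_hasFDerivAt θ hG.hasFDerivAt
  have h2 : fderiv ℝ (fun ϑ => ψ (G ϑ)) θ = ψ' • fderiv ℝ G θ := h1.fderiv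
  simp [gradVec, h2]

lemma gradVec_proj (θ : Fin p → ℝ) (i j : Fin p) :
    gradVec (fun ϑ : Fin p → ℝ => ϑ i) θ j = if i = j then 1 else 0 := by
  have h1 : HasFDerivAt (fun ϑ : Fin p → ℝ => ϑ i)
      (ContinuousLinearMap.proj (R := ℝ) (φ := fun _ : Fin p => ℝ) i) θ :=
    (ContinuousLinearMap.proj (R := ℝ) (φ := fun _ : Fin p => ℝ) i).hasFDerivAt
  rw [gradVec, h1.fderiv]
  simp [Pi.single_apply]

end expLoss

/-! ### Flows converging in direction to a point of positive margin -/

/-- A trajectory `θ` with velocity `-η U`, `U` bounded by `C`, whose direction converges to a unit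
vector `w` at which the homogeneous functions `F i` are at least `γ > 0`. -/
structure MarginFlow {p m : ℕ} (F : Fin m → (Fin p → ℝ) → ℝ) (L : ℝ) (η : ℝ → ℝ)
    (θ U : ℝ → Fin p → ℝ) (C : ℝ) (w : Fin p → ℝ) (γ : ℝ) : Prop where
  contDiff : ∀ i, ContDiff ℝ 1 (F i)
  one_le : 1 ≤ L
  hom : ∀ i (ϑ : Fin p → ℝ) (α : ℝ), 0 < α → F i (α • ϑ) = α ^ L * F i ϑ
  rate_pos : ∀ t, 0 ≤ t → 0 < η t
  rate_anti : AntitoneOn η (Set.Ici 0)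
  rate_decay : η =o[atTop] fun t : ℝ => t ^ (1 / L - 1)
  dir_nonneg : 0 ≤ C
  dir_le : ∀ t, 0 < t → ∀ j, |U t j| ≤ C
  continuousOn : ContinuousOn θ (Set.Ici 0)
  ftc : ∀ (G : (Fin p → ℝ) → ℝ) (a b : ℝ), 0 < a → a ≤ b →
    (∀ t ∈ Set.Icc a b, ContDiffAt ℝ 1 G (θ t)) →
    IntervalIntegrable (fun t => η t * ∑ j, U t j * gradVec G (θ t) j) volume a b ∧
      G (θ b) - G (θ a) = -∫ t in a..b, η t * ∑ j, U t j * gradVec G (θ t) j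
  lower : ∃ N, 0 < N ∧ ∀ᶠ t in atTop, N ≤ ‖θ t‖
  tendsto : Tendsto (fun t => ‖θ t‖⁻¹ • θ t) atTop (𝓝 w)
  margin_pos : 0 < γ
  margin_le : ∀ i, γ ≤ F i w

namespace MarginFlow

variable {p m : ℕ} {F : Fin m → (Fin p → ℝ) → ℝ} {L : ℝ} {η : ℝ → ℝ} {θ U : ℝ → Fin p → ℝ}
  {C : ℝ} {w : Fin p → ℝ} {γ : ℝ} (h : MarginFlow F L η θ U C w γ)

include h

lemma eventually_norm_pos : ∀ᶠ t in atTop, 0 < ‖θ t‖ := by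
  obtain ⟨N, hN, h1⟩ := h.lower
  filter_upwards [h1] with t ht using hN.trans_le ht

lemma value_eq {t : ℝ} (ht : 0 < ‖θ t‖) (i : Fin m) :
    F i (θ t) = ‖θ t‖ ^ L * F i (‖θ t‖⁻¹ • θ t) := by
  rw [← h.hom i _ _ ht, smul_smul, mul_inv_cancel₀ ht.ne', one_smul]

lemma gradVec_eq {t : ℝ} (ht : 0 < ‖θ t‖) (i : Fin m) (j : Fin p) :
    gradVec (F i) (θ t) j = ‖θ t‖ ^ (L - 1) * gradVec (F i) (‖θ t‖⁻¹ • θ t) j := by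
  have h1 := gradVec_smul_of_homogeneous (h.contDiff i) (h.hom i) (‖θ t‖⁻¹ • θ t) ht
  rw [smul_smul, mul_inv_cancel₀ ht.ne', one_smul] at h1
  rw [h1]; rfl

lemma tendsto_value (i : Fin m) :
    Tendsto (fun t => F i (‖θ t‖⁻¹ • θ t)) atTop (𝓝 (F i w)) :=
  ((h.contDiff i).continuous.tendsto w).comp h.tendsto

lemma tendsto_gradVec (i : Fin m) (j : Fin p) :
    Tendsto (fun t => gradVec (F i) (‖θ t‖⁻¹ • θ t) j) atTop (𝓝 (gradVec (F i) w j)) :=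
  (tendsto_pi_nhds.1 (((continuous_gradVec (h.contDiff i)).tendsto w).comp h.tendsto)) j

lemma eventually_value_ge : ∀ᶠ t in atTop, ∀ i, γ / 2 * ‖θ t‖ ^ L ≤ F i (θ t) := by
  rw [eventually_all]
  intro i
  have h1 : γ / 2 < F i w := by linarith [h.margin_le i, h.margin_pos]
  filter_upwards [h.eventually_norm_pos, (h.tendsto_value i).eventually_const_lt h1] with t ht h2
  rw [h.value_eq ht, mul_comm]
  exact mul_le_mul_of_nonneg_left h2.le (Real.rpow_nonneg ht.le _)

lemma eventually_value_pos : ∀ᶠ t in atTop, ∀ i, 0 < F i (θ t) := by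
  filter_upwards [h.eventually_value_ge, h.eventually_norm_pos] with t h1 h2 i
  exact (mul_pos (half_pos h.margin_pos) (Real.rpow_pos_of_pos h2 _)).trans_le (h1 i)

/-- A uniform bound for the gradients near the limit direction. -/
lemma exists_gradVec_bound : ∃ K, 0 ≤ K ∧ (∀ i j, |gradVec (F i) w j| ≤ K) ∧
    ∀ᶠ t in atTop, ∀ i j, |gradVec (F i) (‖θ t‖⁻¹ • θ t) j| ≤ K := by
  set K := (∑ i, ∑ j, |gradVec (F i) w j|) + 1 with hK
  have h1 : ∀ i j, |gradVec (F i) w j| ≤ ∑ i, ∑ j, |gradVec (F i) w j| := fun i j =>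
    (Finset.single_le_sum (f := fun j => |gradVec (F i) w j|) (fun _ _ => abs_nonneg _)
      (Finset.mem_univ j)).trans
    (Finset.single_le_sum (f := fun i => ∑ j, |gradVec (F i) w j|)
      (fun _ _ => Finset.sum_nonneg fun _ _ => abs_nonneg _) (Finset.mem_univ i))
  refine ⟨K, by positivity, fun i j => (h1 i j).trans (by linarith), ?_⟩
  rw [eventually_all]; intro i
  rw [eventually_all]; intro j
  have h2 : |gradVec (F i) w j| < K := by linarith [h1 i j]
  filter_upwards [((h.tendsto_gradVec i j).abs).eventually_lt_const h2] with t ht using ht.le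

lemma abs_sub_le_integral {G : (Fin p → ℝ) → ℝ} {a b : ℝ} (ha : 0 < a) (hab : a ≤ b)
    (hG : ∀ t ∈ Set.Icc a b, ContDiffAt ℝ 1 G (θ t)) {δ : ℝ}
    (hδ : ∀ t ∈ Set.Icc a b, η t * ∑ j, |gradVec G (θ t) j| * C ≤ δ) :
    |G (θ a) - G (θ b)| ≤ δ * (b - a) := by
  rw [abs_sub_comm, (h.ftc G a b ha hab hG).2, abs_neg]
  have h1 : ∀ t ∈ Set.uIoc a b, ‖η t * ∑ j, U t j * gradVec G (θ t) j‖ ≤ δ := by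
    intro t ht
    rw [Set.uIoc_of_le hab] at ht
    have ht0 : 0 < t := ha.trans ht.1
    refine le_trans ?_ (hδ t ⟨ht.1.le, ht.2⟩)
    rw [norm_mul, Real.norm_of_nonneg (h.rate_pos t ht0.le).le]
    refine mul_le_mul_of_nonneg_left ?_ (h.rate_pos t ht0.le).le
    refine (norm_sum_le _ _).trans (Finset.sum_le_sum fun j _ => ?_)
    rw [norm_mul, mul_comm]
    exact mul_le_mul_of_nonneg_left (h.dir_le t ht0 j) (norm_nonneg _)
  have h2 := intervalIntegral.norm_integral_le_of_norm_le_const h1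
  rwa [abs_of_nonneg (sub_nonneg.2 hab)] at h2

lemma eventually_rate_le {ε : ℝ} (hε : 0 < ε) :
    ∀ᶠ t in atTop, η t ≤ ε * t ^ (1 / L - 1) := by
  filter_upwards [h.rate_decay.def hε, eventually_gt_atTop 0] with t ht ht0
  rw [Real.norm_of_nonneg (h.rate_pos t ht0.le).le,
    Real.norm_of_nonneg (Real.rpow_nonneg ht0.le _)] at ht
  exact ht

lemma eventually_rate_le_const {ε : ℝ} (hε : 0 < ε) : ∀ᶠ t in atTop, η t ≤ ε := by
  filter_upwards [h.eventually_rate_le hε, eventually_ge_atTop 1] with t ht ht1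
  have h1 : t ^ (1 / L - 1) ≤ 1 := by
    refine Real.rpow_le_one_of_one_le_of_nonpos ht1 ?_
    rw [sub_nonpos, div_le_one (by linarith [h.one_le])]
    exact h.one_le
  nlinarith

lemma abs_coord_sub_le {a b : ℝ} (ha : 0 < a) (hab : a ≤ b) (j : Fin p) :
    |θ b j - θ a j| ≤ ∫ t in a..b, η t * C := by
  have h1 := h.ftc (fun ϑ => ϑ j) a b ha hab fun t _ => (contDiff_apply ℝ ℝ j).contDiffAt
  simp only [gradVec_proj, mul_ite, mul_one, mul_zero, Finset.sum_ite_eq, Finset.mem_univ,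
    if_true] at h1
  rw [h1.2, abs_neg]
  have hηi : IntervalIntegrable η volume a b :=
    (h.rate_anti.mono fun x hx => by
      rw [Set.uIcc_of_le hab] at hx; exact ha.le.trans hx.1).intervalIntegrable
  rw [← Real.norm_eq_abs]
  refine intervalIntegral.norm_integral_le_of_norm_le (μ := volume) hab
    (Eventually.of_forall fun t ht => ?_) (hηi.mul_const C)
  have ht0 : 0 < t := ha.trans ht.1
  rw [norm_mul, Real.norm_of_nonneg (h.rate_pos t ht0.le).le]
  exact mul_le_mul_of_nonneg_left (h.dir_le t ht0 j) (h.rate_pos t ht0.le).le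

/-- The trajectory grows at most like `t ^ (1 / L)`. -/
lemma exists_norm_le_rpow : ∃ D, 0 < D ∧ ∀ᶠ t in atTop, ‖θ t‖ ≤ D * t ^ (1 / L) := by
  have hL0 : 0 < L := by linarith [h.one_le]
  have hC := h.dir_nonneg
  obtain ⟨T₀, hT₀⟩ := eventually_atTop.1 (h.eventually_rate_le one_pos)
  set T := max T₀ 1 with hT
  have hT1 : 1 ≤ T := le_max_right _ _
  have hT0 : 0 < T := by linarith
  refine ⟨‖θ T‖ + C * L + 1, by positivity, ?_⟩
  filter_upwards [eventually_ge_atTop T] with t ht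
  have ht1 : 1 ≤ t := hT1.trans ht
  have ht0 : 0 < t := by linarith
  have hr : -1 < 1 / L - 1 := by have : 0 < 1 / L := by positivity
                                 linarith
  have hηi : IntervalIntegrable η volume T t :=
    (h.rate_anti.mono fun x hx => by
      rw [Set.uIcc_of_le ht] at hx; exact hT0.le.trans hx.1).intervalIntegrable
  have h1 : ∫ s in T..t, η s * C ≤ C * L * t ^ (1 / L) := by
    have h2 : ∫ s in T..t, η s * C ≤ ∫ s in T..t, s ^ (1 / L - 1) * C := by
      refine intervalIntegral.integral_mono_on ht (hηi.mul_const C)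
        ((intervalIntegral.intervalIntegrable_rpow' hr).mul_const C) fun s hs => ?_
      have h3 := hT₀ s ((le_max_left _ _).trans hs.1)
      rw [one_mul] at h3
      exact mul_le_mul_of_nonneg_right h3 hC
    rw [intervalIntegral.integral_mul_const (r := C) (f := fun s => s ^ (1 / L - 1)),
      integral_rpow (Or.inl hr), sub_add_cancel] at h2
    have h3 : 0 ≤ T ^ (1 / L) := Real.rpow_nonneg hT0.le _
    calc _ ≤ _ := h2
      _ = C * L * (t ^ (1 / L) - T ^ (1 / L)) := by field_simp
      _ ≤ C * L * t ^ (1 / L) := by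
        refine mul_le_mul_of_nonneg_left ?_ (by positivity)
        linarith
  have h2 : 1 ≤ t ^ (1 / L) := Real.one_le_rpow ht1 (by positivity)
  refine (pi_norm_le_iff_of_nonneg (by positivity)).2 fun j => ?_
  have h3 := (h.abs_coord_sub_le hT0 ht j).trans h1
  have h4 : |θ T j| ≤ ‖θ T‖ := norm_le_pi_norm (θ T) j
  have h5 : |θ t j| ≤ |θ t j - θ T j| + |θ T j| := by
    have := abs_add_le (θ t j - θ T j) (θ T j)
    rwa [sub_add_cancel] at this
  rw [Real.norm_eq_abs]
  nlinarith [norm_nonneg (θ T)]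

/-- The growth `‖θ‖ ^ (L - 1) = O(t ^ (1 - 1 / L))` is exactly what the decay assumption on `η`
compensates. -/
lemma eventually_rate_mul_rpow_le {ε : ℝ} (hε : 0 < ε) :
    ∀ᶠ t in atTop, η t * ‖θ t‖ ^ (L - 1) ≤ ε := by
  have hL0 : 0 < L := by linarith [h.one_le]
  obtain ⟨D, hD, h1⟩ := h.exists_norm_le_rpow
  have hD' : 0 < D ^ (L - 1) := Real.rpow_pos_of_pos hD _
  filter_upwards [h1, h.eventually_rate_le (div_pos hε hD'), eventually_gt_atTop 0] with t h2 h3 ht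
  have h4 : ‖θ t‖ ^ (L - 1) ≤ D ^ (L - 1) * t ^ (1 - 1 / L) := by
    refine (Real.rpow_le_rpow (norm_nonneg _) h2 (by linarith [h.one_le])).trans_eq ?_
    rw [Real.mul_rpow hD.le (Real.rpow_nonneg ht.le _), ← Real.rpow_mul ht.le]
    congr 2
    field_simp
  have h5 : t ^ (1 / L - 1) * t ^ (1 - 1 / L) = 1 := by
    rw [← Real.rpow_add ht]; simp
  calc η t * ‖θ t‖ ^ (L - 1)
      ≤ (ε / D ^ (L - 1) * t ^ (1 / L - 1)) * (D ^ (L - 1) * t ^ (1 - 1 / L)) :=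
        mul_le_mul h3 h4 (Real.rpow_nonneg (norm_nonneg _) _)
          (mul_nonneg (by positivity) (Real.rpow_nonneg ht.le _))
    _ = (ε / D ^ (L - 1) * D ^ (L - 1)) * (t ^ (1 / L - 1) * t ^ (1 - 1 / L)) := by ring
    _ = ε := by rw [h5]; field_simp

/-- The speed of `F i (θ t)` is at most a constant times `η t * ‖θ t‖ ^ (L - 1)`, which tends to
`0`. -/
lemma exists_value_lipschitz {δ : ℝ} (hδ : 0 < δ) : ∃ T, 0 < T ∧ ∀ s t, T ≤ s → s ≤ t →
    ∀ i, |F i (θ s) - F i (θ t)| ≤ δ * (t - s) := by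
  obtain ⟨K, hK, -, h1⟩ := h.exists_gradVec_bound
  have hC := h.dir_nonneg
  set E := p * (K * C) + 1 with hE
  have hE0 : 0 < E := by positivity
  obtain ⟨T, hT⟩ := eventually_atTop.1 ((h1.and h.eventually_norm_pos).and
    (h.eventually_rate_mul_rpow_le (div_pos hδ hE0)))
  refine ⟨max T 1, by positivity, fun s t hs hst i => ?_⟩
  have hs0 : 0 < s := by linarith [(le_max_right T 1).trans hs]
  refine h.abs_sub_le_integral hs0 hst (fun t _ => (h.contDiff i).contDiffAt) fun r hr => ?_
  obtain ⟨⟨h2, h3⟩, h4⟩ := hT r (((le_max_left _ _).trans hs).trans hr.1)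
  have hηr := h.rate_pos r (hs0.le.trans hr.1)
  have hρ : 0 ≤ ‖θ r‖ ^ (L - 1) := Real.rpow_nonneg h3.le _
  have h5 : ∑ j, |gradVec (F i) (θ r) j| * C ≤ ∑ _j : Fin p, ‖θ r‖ ^ (L - 1) * (K * C) := by
    refine Finset.sum_le_sum fun j _ => ?_
    rw [h.gradVec_eq h3, abs_mul, abs_of_nonneg hρ, mul_assoc]
    exact mul_le_mul_of_nonneg_left (mul_le_mul_of_nonneg_right (h2 i j) hC) hρ
  rw [Finset.sum_const, Finset.card_univ, Fintype.card_fin, nsmul_eq_mul] at h5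
  calc η r * ∑ j, |gradVec (F i) (θ r) j| * C
      ≤ η r * (p * (‖θ r‖ ^ (L - 1) * (K * C))) := mul_le_mul_of_nonneg_left h5 hηr.le
    _ = (η r * ‖θ r‖ ^ (L - 1)) * (p * (K * C)) := by ring
    _ ≤ δ / E * E := by
      refine mul_le_mul h4 (by linarith) (by positivity) (by positivity)
    _ = δ := by field_simp

lemma exists_norm_lipschitz {δ : ℝ} (hδ : 0 < δ) : ∃ T, 0 < T ∧ ∀ s t, T ≤ s → s ≤ t →
    ‖θ s - θ t‖ ≤ δ * (t - s) := by
  have hC := h.dir_nonneg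
  obtain ⟨T, hT⟩ := eventually_atTop.1
    (h.eventually_rate_le_const (div_pos hδ (by positivity : 0 < C + 1)))
  refine ⟨max T 1, by positivity, fun s t hs hst => ?_⟩
  have hs0 : 0 < s := by linarith [(le_max_right T 1).trans hs]
  refine (pi_norm_le_iff_of_nonneg (mul_nonneg hδ.le (sub_nonneg.2 hst))).2 fun j => ?_
  refine h.abs_sub_le_integral (G := fun ϑ => ϑ j) hs0 hst
    (fun t _ => (contDiff_apply ℝ ℝ j).contDiffAt) fun r hr => ?_
  have h1 : ∑ k, |gradVec (fun ϑ : Fin p → ℝ => ϑ j) (θ r) k| * C = C := by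
    simp only [gradVec_proj]
    rw [Finset.sum_eq_single j] <;> simp +contextual [eq_comm]
  rw [h1]
  have h2 := hT r (((le_max_left _ _).trans hs).trans hr.1)
  calc η r * C ≤ δ / (C + 1) * (C + 1) := mul_le_mul h2 (by linarith) hC (by positivity)
    _ = δ := by field_simp

end MarginFlow

/-! ### Slowly varying combinations -/

lemma SlowlyVarying.sum_mul {m : ℕ} {b : Fin m → ℝ → ℝ}
    (hb : ∀ i, SlowlyVarying (b i) (b i)) {k : Fin m → ℝ} {K : ℝ} (hk : ∀ i, |k i| ≤ K)
    {T₀ : ℝ} (hpos : ∀ t, T₀ ≤ t → ∀ i, 0 < b i t) :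
    SlowlyVarying (fun t => ∑ i, b i t * k i) (fun t => ∑ i, b i t) := by
  intro δ hδ
  have hK1 : 0 < |K| + 1 := by positivity
  have hK2 : ∀ i, |k i| ≤ |K| + 1 := fun i => (hk i).trans (by linarith [le_abs_self K])
  set ε := δ / (|K| + 1) with hε
  have hε0 : 0 < ε := by positivity
  have hεδ : ε ≤ δ := div_le_self hδ.le (by linarith [abs_nonneg K])
  choose T hT h using fun i => hb i ε hε0
  refine ⟨max T₀ (∑ i, T i), (Finset.sum_nonneg fun i _ => hT i).trans (le_max_right _ _),
    fun s t hs hst => ?_⟩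
  have hTs : ∀ i, T i ≤ s := fun i =>
    ((Finset.single_le_sum (fun i _ => hT i) (Finset.mem_univ i)).trans
      (le_max_right _ _)).trans hs
  have hbt := hpos t (((le_max_left _ _).trans hs).trans hst)
  have he : Real.exp (ε * (t - s)) ≤ Real.exp (δ * (t - s)) :=
    Real.exp_le_exp.2 (mul_le_mul_of_nonneg_right hεδ (sub_nonneg.2 hst))
  rw [← Finset.sum_sub_distrib, Finset.mul_sum]
  refine (Finset.abs_sum_le_sum_abs _ _).trans (Finset.sum_le_sum fun i _ => ?_)
  rw [← sub_mul, abs_mul]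
  calc |b i s - b i t| * |k i|
      ≤ (ε * Real.exp (ε * (t - s)) * b i t) * (|K| + 1) :=
        mul_le_mul (h i s t (hTs i) hst) (hK2 i) (abs_nonneg _)
          (mul_nonneg (by positivity) (hbt i).le)
    _ ≤ (ε * Real.exp (δ * (t - s)) * b i t) * (|K| + 1) := by
        have := (hbt i).le
        gcongr
    _ = (ε * (|K| + 1)) * Real.exp (δ * (t - s)) * b i t := by ring
    _ = δ * Real.exp (δ * (t - s)) * b i t := by rw [hε, div_mul_cancel₀ _ hK1.ne']

/-- Used to pass from gradients frozen at the limit direction, with constant coefficients, to the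
gradients actually met along the flow. -/
lemma SlowlyVarying.of_close {h g A : ℝ → ℝ} (hh : SlowlyVarying h A) (hA : SlowlyVarying A A)
    {T₀ : ℝ} (hpos : ∀ t, T₀ ≤ t → 0 < A t)
    (hg : ∀ ε, 0 < ε → ∀ᶠ t in atTop, |g t - h t| ≤ ε * A t) : SlowlyVarying g A := by
  intro δ hδ
  set ε := min 1 (δ / 4) with hε
  have hε0 : 0 < ε := by positivity
  have hε1 : ε ≤ 1 := min_le_left _ _
  have hε4 : ε ≤ δ / 4 := min_le_right _ _
  obtain ⟨T₁, hT₁, h1⟩ := hh ε hε0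
  obtain ⟨T₂, hT₂, h2⟩ := hA ε hε0
  obtain ⟨T₃, h3⟩ := eventually_atTop.1 (hg ε hε0)
  refine ⟨max (max T₀ T₁) (max T₂ T₃), hT₁.trans ((le_max_right _ _).trans (le_max_left _ _)),
    fun s t hs hst => ?_⟩
  have hs0 : T₀ ≤ s := ((le_max_left _ _).trans (le_max_left _ _)).trans hs
  have hs1 : T₁ ≤ s := ((le_max_right _ _).trans (le_max_left _ _)).trans hs
  have hs2 : T₂ ≤ s := ((le_max_left _ _).trans (le_max_right _ _)).trans hs
  have hs3 : T₃ ≤ s := ((le_max_right _ _).trans (le_max_right _ _)).trans hs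
  have hAt := hpos t (hs0.trans hst)
  set e := Real.exp (ε * (t - s)) with he
  have he1 : 1 ≤ e := Real.one_le_exp (mul_nonneg hε0.le (sub_nonneg.2 hst))
  have heδ : e ≤ Real.exp (δ * (t - s)) :=
    Real.exp_le_exp.2 (mul_le_mul_of_nonneg_right (by linarith) (sub_nonneg.2 hst))
  have h4 : A s ≤ 2 * (e * A t) := by
    have h5 := (abs_le.1 (h2 s t hs2 hst)).2
    have h6 : ε * e * A t ≤ 1 * e * A t := by gcongr
    nlinarith
  have h5 : |g s - g t| ≤ |g s - h s| + |h s - h t| + |g t - h t| := by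
    have h6 := abs_sub_le (g s) (h s) (g t)
    have h7 := abs_sub_le (h s) (h t) (g t)
    rw [abs_sub_comm (h t)] at h7
    linarith
  have h6 := h3 s hs3
  have h7 := h3 t (hs3.trans hst)
  have h8 := h1 s t hs1 hst
  have h9 : ε * A s ≤ ε * (2 * (e * A t)) := mul_le_mul_of_nonneg_left h4 hε0.le
  have h10 : ε * A t ≤ ε * (e * A t) := mul_le_mul_of_nonneg_left (by nlinarith) hε0.le
  calc |g s - g t| ≤ 4 * ε * e * A t := by linarith
    _ ≤ δ * Real.exp (δ * (t - s)) * A t := by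
      have h11 : 4 * ε ≤ δ := by linarith
      gcongr

/-- If `m` and `v` approximate `g` and `g ^ 2`, then `m / √v` is almost dual to `g`. -/
lemma sub_le_mul_div_sqrt {g m v e C : ℝ} (hv : 0 < v) (he : 0 ≤ e) (hm : |m - g| ≤ e)
    (hvg : |v - g ^ 2| ≤ e ^ 2) (hC : |m / Real.sqrt v| ≤ C) :
    |g| - (3 + C) * e ≤ m / Real.sqrt v * g := by
  have hs : 0 < Real.sqrt v := Real.sqrt_pos.2 hv
  have hsq : Real.sqrt v ^ 2 = v := Real.sq_sqrt hv.le
  have h1 : Real.sqrt v ≤ |g| + e := by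
    rw [Real.sqrt_le_left (by positivity)]
    have := (abs_le.1 hvg).2
    nlinarith [sq_abs g, mul_nonneg (abs_nonneg g) he]
  have h2 : |g| - e ≤ |m| := by
    have := abs_sub_abs_le_abs_sub g m
    rw [abs_sub_comm g m] at this
    linarith
  set u := m / Real.sqrt v with hu
  have hmu : m = u * Real.sqrt v := by rw [hu]; field_simp
  -- This is `(|u| - 1) ^ 2 ≥ 0` multiplied by `√v`; it avoids dividing by a possibly tiny `√v`.
  have h3 : 2 * |m| - Real.sqrt v ≤ u * m := by
    rw [hmu, abs_mul, abs_of_pos hs]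
    nlinarith [sq_nonneg (|u| - 1), sq_abs u, mul_nonneg (sq_nonneg (|u| - 1)) hs.le]
  have h4 : u * (m - g) ≤ C * e := by
    calc u * (m - g) ≤ |u * (m - g)| := le_abs_self _
      _ = |u| * |m - g| := abs_mul _ _
      _ ≤ C * e := mul_le_mul hC hm (abs_nonneg _) ((abs_nonneg _).trans hC)
  nlinarith

/-! ### Asymptotic duality of the Adam direction and the gradient -/

namespace MarginFlow

variable {p m : ℕ} {F : Fin m → (Fin p → ℝ) → ℝ} {L : ℝ} {η : ℝ → ℝ} {θ U : ℝ → Fin p → ℝ}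
  {C : ℝ} {w : Fin p → ℝ} {γ : ℝ} {φ : ℝ → ℝ}

/-- The weight of the `i`-th gradient at the normalized parameter. -/
noncomputable def weight (φ : ℝ → ℝ) (F : Fin m → (Fin p → ℝ) → ℝ) (L : ℝ) (θ : ℝ → Fin p → ℝ)
    (i : Fin m) (t : ℝ) : ℝ :=
  lossWeight φ F (θ t) i * ‖θ t‖ ^ (L - 1)

/-- The gradient scale. -/
noncomputable def scale (φ : ℝ → ℝ) (F : Fin m → (Fin p → ℝ) → ℝ) (L : ℝ) (θ : ℝ → Fin p → ℝ)
    (t : ℝ) : ℝ :=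
  ∑ i, weight φ F L θ i t

lemma weight_pos (hφ : IsLossExponent φ) {t : ℝ} (ht : 0 < ‖θ t‖) (i : Fin m) :
    0 < weight φ F L θ i t :=
  mul_pos (mul_pos (Real.exp_pos _) (hφ.deriv_pos _)) (Real.rpow_pos_of_pos ht _)

lemma scale_pos [NeZero m] (hφ : IsLossExponent φ) {t : ℝ} (ht : 0 < ‖θ t‖) :
    0 < scale φ F L θ t :=
  Finset.sum_pos (fun i _ => weight_pos hφ ht i) ⟨0, Finset.mem_univ _⟩

variable (h : MarginFlow F L η θ U C w γ) (hφ : IsLossExponent φ)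

include h hφ

lemma gradVec_expLoss_eq {t : ℝ} (ht : 0 < ‖θ t‖) (j : Fin p) :
    gradVec (expLoss φ F) (θ t) j =
      -∑ i, weight φ F L θ i t * gradVec (F i) (‖θ t‖⁻¹ • θ t) j := by
  rw [gradVec_expLoss hφ h.contDiff]
  congr 1
  refine Finset.sum_congr rfl fun i _ => ?_
  rw [h.gradVec_eq ht, weight]
  ring

/-- The logarithm of the weight is `-φ (F i) + log φ' (F i) + (L - 1) log ‖θ‖`. Each term is a
Lipschitz function of `F i (θ t)` or `‖θ t‖`, whose Lipschitz constants in time tend to `0`; the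
lower bound on the norm handles the last term. -/
lemma slowlyVarying_weight (i : Fin m) :
    SlowlyVarying (weight φ F L θ i) (weight φ F L θ i) := by
  obtain ⟨T₀, hT₀⟩ := eventually_atTop.1 h.eventually_norm_pos
  refine slowlyVarying_of_log (T₀ := T₀) (fun t ht => weight_pos hφ (hT₀ t ht) i) fun δ hδ => ?_
  obtain ⟨K, hK, hlog⟩ := hφ.exists_abs_log_sub_le
  obtain ⟨N, hN, hlow⟩ := h.lower
  obtain ⟨T₁, hT₁⟩ := eventually_atTop.1 (hlow.and h.eventually_value_pos)
  have hκ := hφ.iSup_pos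
  set κ := ⨆ v, deriv φ v with hκdef
  have hL := h.one_le
  have hE1 : 0 < κ + K := by positivity
  have hE2 : 0 < (L - 1) / N + 1 := by
    have : 0 ≤ (L - 1) / N := div_nonneg (by linarith) hN.le
    linarith
  obtain ⟨T₂, hT₂, hq⟩ := h.exists_value_lipschitz (div_pos (half_pos hδ) hE1)
  obtain ⟨T₃, hT₃, hρ⟩ := h.exists_norm_lipschitz (div_pos (half_pos hδ) hE2)
  refine ⟨max T₁ (max T₂ T₃), hT₂.le.trans ((le_max_left _ _).trans (le_max_right _ _)),
    fun s t hs hst => ?_⟩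
  have hs1 : T₁ ≤ s := (le_max_left _ _).trans hs
  have hs2 : T₂ ≤ s := ((le_max_left _ _).trans (le_max_right _ _)).trans hs
  have hs3 : T₃ ≤ s := ((le_max_right _ _).trans (le_max_right _ _)).trans hs
  obtain ⟨hNs, hqs⟩ := hT₁ s hs1
  obtain ⟨hNt, hqt⟩ := hT₁ t (hs1.trans hst)
  have hlogw : ∀ r, N ≤ ‖θ r‖ → Real.log (weight φ F L θ i r) =
      -φ (F i (θ r)) + Real.log (deriv φ (F i (θ r))) + (L - 1) * Real.log ‖θ r‖ := by
    intro r hr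
    have hr0 := hN.trans_le hr
    rw [weight, lossWeight, Real.log_mul
      (mul_pos (Real.exp_pos _) (hφ.deriv_pos _)).ne' (Real.rpow_pos_of_pos hr0 _).ne',
      Real.log_mul (Real.exp_pos _).ne' (hφ.deriv_pos _).ne', Real.log_exp, Real.log_rpow hr0]
  rw [hlogw s hNs, hlogw t hNt]
  have h1 := hφ.abs_sub_le (F i (θ s)) (F i (θ t))
  have h2 := hlog _ _ (hqs i).le (hqt i).le
  have h3 : |Real.log ‖θ s‖ - Real.log ‖θ t‖| ≤ 1 / N * |‖θ s‖ - ‖θ t‖| := by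
    have h4 : ∀ a b : ℝ, N ≤ a → N ≤ b → Real.log a - Real.log b ≤ 1 / N * |a - b| := by
      intro a b ha hb
      have ha0 := hN.trans_le ha
      have hb0 := hN.trans_le hb
      rw [← Real.log_div ha0.ne' hb0.ne']
      refine (Real.log_le_sub_one_of_pos (div_pos ha0 hb0)).trans ?_
      rw [show a / b - 1 = 1 / b * (a - b) by field_simp]
      calc 1 / b * (a - b) ≤ 1 / b * |a - b| :=
            mul_le_mul_of_nonneg_left (le_abs_self _) (by positivity)
        _ ≤ 1 / N * |a - b| :=
            mul_le_mul_of_nonneg_right (one_div_le_one_div_of_le hN hb) (abs_nonneg _)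
    rw [abs_le]
    constructor
    · have := h4 _ _ hNt hNs
      rw [abs_sub_comm] at this
      linarith
    · exact h4 _ _ hNs hNt
  have h5 := hq s t hs2 hst i
  have h6 := (abs_norm_sub_norm_le (θ s) (θ t)).trans (hρ s t hs3 hst)
  have h7 : κ * |F i (θ s) - F i (θ t)| + K * |F i (θ s) - F i (θ t)| ≤ δ / 2 * (t - s) := by
    calc _ = (κ + K) * |F i (θ s) - F i (θ t)| := by ring
      _ ≤ (κ + K) * (δ / 2 / (κ + K) * (t - s)) := mul_le_mul_of_nonneg_left h5 hE1.le
      _ = _ := by field_simp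
  have h8 : (L - 1) * |Real.log ‖θ s‖ - Real.log ‖θ t‖| ≤ δ / 2 * (t - s) := by
    calc _ ≤ (L - 1) * (1 / N * |‖θ s‖ - ‖θ t‖|) :=
          mul_le_mul_of_nonneg_left h3 (by linarith)
      _ = (L - 1) / N * |‖θ s‖ - ‖θ t‖| := by ring
      _ ≤ ((L - 1) / N + 1) * (δ / 2 / ((L - 1) / N + 1) * (t - s)) :=
          mul_le_mul (by linarith) h6 (abs_nonneg _) hE2.le
      _ = _ := by rw [← mul_assoc, mul_div_cancel₀ _ hE2.ne']
  have h9 : |(L - 1) * (Real.log ‖θ s‖ - Real.log ‖θ t‖)|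
      = (L - 1) * |Real.log ‖θ s‖ - Real.log ‖θ t‖| := by
    rw [abs_mul, abs_of_nonneg (by linarith : 0 ≤ L - 1)]
  rw [abs_le] at h1 h2 ⊢
  have h10 := abs_le.1 h9.le
  constructor <;> linarith [h10.1, h10.2, h1.1, h1.2, h2.1, h2.2]

/-- Along the flow, the bias-corrected Adam direction is asymptotically dual to the gradient. -/
lemma eventually_descent [NeZero m] {g : ℝ → Fin p → ℝ} (hgc : ∀ j, Continuous fun t => g t j)
    (hg : ∀ t, 0 ≤ t → g t = gradVec (expLoss φ F) (θ t)) {c₁ c₂ : ℝ} (hc₁ : 0 < c₁)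
    (hc₂ : 0 < c₂) (hU : ∀ t, 0 < t → ∀ j, U t j = emaHat c₁ (fun s => g s j) t /
      Real.sqrt (emaHat c₂ (fun s => g s j ^ 2) t))
    (hv : ∀ t, 0 < t → ∀ j, 0 < emaHat c₂ (fun s => g s j ^ 2) t) {ε : ℝ} (hε : 0 < ε) :
    ∀ᶠ t in atTop, (∑ j, |∑ i, weight φ F L θ i t * gradVec (F i) w j|)
      - ε * scale φ F L θ t ≤ ∑ j, U t j * g t j := by
  obtain ⟨T₀, hT₀⟩ := eventually_atTop.1 h.eventually_norm_pos
  obtain ⟨K, hK, hKw, hKt⟩ := h.exists_gradVec_bound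
  have hwpos : ∀ t, T₀ ≤ t → ∀ i, 0 < weight φ F L θ i t := fun t ht i =>
    weight_pos hφ (hT₀ t ht) i
  have hApos : ∀ t, T₀ ≤ t → 0 < scale φ F L θ t := fun t ht => scale_pos hφ (hT₀ t ht)
  have hAA : SlowlyVarying (scale φ F L θ) (scale φ F L θ) := by
    have h1 := SlowlyVarying.sum_mul (h.slowlyVarying_weight hφ) (k := fun _ => 1) (K := 1)
      (by simp) hwpos
    simp only [mul_one] at h1
    exact h1
  have hC := h.dir_nonneg
  set G : Fin p → ℝ → ℝ := fun j t => ∑ i, weight φ F L θ i t * gradVec (F i) w j with hG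
  have hGslow : ∀ j, SlowlyVarying (G j) (scale φ F L θ) := fun j =>
    SlowlyVarying.sum_mul (h.slowlyVarying_weight hφ) (fun i => hKw i j) hwpos
  -- The loss decreases in the margins, so it is `-g` that approximates the weighted sum `G` of
  -- margin gradients.
  have hclose : ∀ j, ∀ ε, 0 < ε → ∀ᶠ t in atTop, |(-g t j) - G j t| ≤ ε * scale φ F L θ t := by
    intro j ε hε
    have h1 : ∀ᶠ t in atTop, ∀ i,
        |gradVec (F i) (‖θ t‖⁻¹ • θ t) j - gradVec (F i) w j| ≤ ε := by
      rw [eventually_all]; intro i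
      have h2 := ((h.tendsto_gradVec i j).sub_const (gradVec (F i) w j)).abs
      rw [sub_self, abs_zero] at h2
      filter_upwards [h2.eventually_lt_const hε] with t ht using ht.le
    filter_upwards [h1, eventually_ge_atTop T₀, eventually_ge_atTop 0] with t h2 h3 h4
    rw [hg t h4, h.gradVec_expLoss_eq hφ (hT₀ t h3), neg_neg, hG, ← Finset.sum_sub_distrib,
      scale, Finset.mul_sum]
    refine (Finset.abs_sum_le_sum_abs _ _).trans (Finset.sum_le_sum fun i _ => ?_)
    rw [← mul_sub, abs_mul, abs_of_pos (hwpos t h3 i), mul_comm]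
    exact mul_le_mul_of_nonneg_right (h2 i) (hwpos t h3 i).le
  have hgslow : ∀ j, SlowlyVarying (fun t => g t j) (scale φ F L θ) := by
    intro j δ hδ
    obtain ⟨T, hT, h1⟩ := SlowlyVarying.of_close (hGslow j) hAA hApos (hclose j) δ hδ
    refine ⟨T, hT, fun s t hs hst => ?_⟩
    have h2 := h1 s t hs hst
    rwa [show -g s j - -g t j = -(g s j - g t j) by ring, abs_neg] at h2
  have hgb : ∀ᶠ t in atTop, ∀ j, |g t j| ≤ K * scale φ F L θ t := by
    filter_upwards [hKt, eventually_ge_atTop T₀, eventually_ge_atTop 0] with t h2 h3 h4 j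
    rw [hg t h4, h.gradVec_expLoss_eq hφ (hT₀ t h3), abs_neg, scale, Finset.mul_sum]
    refine (Finset.abs_sum_le_sum_abs _ _).trans (Finset.sum_le_sum fun i _ => ?_)
    rw [abs_mul, abs_of_pos (hwpos t h3 i), mul_comm]
    exact mul_le_mul_of_nonneg_right (h2 i j) (hwpos t h3 i).le
  obtain ⟨T₁, hT₁⟩ := eventually_atTop.1 hgb
  have hg2slow : ∀ j, SlowlyVarying (fun t => g t j ^ 2) (fun t => scale φ F L θ t ^ 2) :=
    fun j => (hgslow j).sq hAA (T₀ := max T₀ T₁)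
      (fun t ht => hT₁ t ((le_max_right _ _).trans ht) j)
      (fun t ht => hApos t ((le_max_left _ _).trans ht))
  have hA2 : SlowlyVarying (fun t => scale φ F L θ t ^ 2) (fun t => scale φ F L θ t ^ 2) :=
    hAA.sq hAA (T₀ := T₀) (K := 1)
      (fun t ht => by rw [abs_of_pos (hApos t ht), one_mul]) hApos
  -- Each of the `p` coordinates loses `(3 + C) * ε'` to duality and one more `ε'` to replacing `g`
  -- by `G`.
  set ε' := ε / ((p + 1) * (4 + C)) with hε'
  have hε'0 : 0 < ε' := by positivity
  have hε'p : p * (4 + C) * ε' ≤ ε := by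
    have h1 : (p + 1) * (4 + C) * ε' = ε := by rw [hε']; field_simp
    have h2 : 0 ≤ (4 + C) * ε' := by positivity
    linarith
  have hm : ∀ᶠ t in atTop, ∀ j,
      |emaHat c₁ (fun s => g s j) t - g t j| ≤ ε' * scale φ F L θ t :=
    eventually_all.2 fun j => (hgslow j).emaHat_sub_le hAA (hgc j) hApos hc₁ hε'0
  have hv2 : ∀ᶠ t in atTop, ∀ j, |emaHat c₂ (fun s => g s j ^ 2) t - g t j ^ 2|
      ≤ ε' ^ 2 * scale φ F L θ t ^ 2 :=
    eventually_all.2 fun j => (hg2slow j).emaHat_sub_le hA2 ((hgc j).pow 2)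
      (fun t ht => pow_pos (hApos t ht) 2) hc₂ (by positivity)
  have hcl : ∀ᶠ t in atTop, ∀ j, |(-g t j) - G j t| ≤ ε' * scale φ F L θ t :=
    eventually_all.2 fun j => hclose j ε' hε'0
  filter_upwards [hm, hv2, hcl, eventually_gt_atTop 0, eventually_ge_atTop T₀]
    with t h1 h2 h3 h4 h5
  have hA := hApos t h5
  have hj : ∀ j, |G j t| - (4 + C) * (ε' * scale φ F L θ t) ≤ U t j * g t j := by
    intro j
    have h6 : |emaHat c₁ (fun s => g s j) t / Real.sqrt (emaHat c₂ (fun s => g s j ^ 2) t)| ≤ C :=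
      hU t h4 j ▸ h.dir_le t h4 j
    have h7 := sub_le_mul_div_sqrt (hv t h4 j) (by positivity) (h1 j)
      (by rw [mul_pow]; exact h2 j) h6
    rw [← hU t h4 j] at h7
    have h8 : |G j t| ≤ |g t j| + ε' * scale φ F L θ t := by
      have h9 := abs_sub_abs_le_abs_sub (G j t) (-g t j)
      rw [abs_sub_comm, abs_neg] at h9
      linarith [h3 j]
    linarith
  calc (∑ j, |G j t|) - ε * scale φ F L θ t
      ≤ (∑ j, |G j t|) - p * (4 + C) * ε' * scale φ F L θ t := by
        have := mul_le_mul_of_nonneg_right hε'p hA.le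
        linarith
    _ = ∑ j, (|G j t| - (4 + C) * (ε' * scale φ F L θ t)) := by
        rw [Finset.sum_sub_distrib, Finset.sum_const, Finset.card_univ, Fintype.card_fin,
          nsmul_eq_mul]
        ring
    _ ≤ _ := Finset.sum_le_sum fun j _ => hj j

end MarginFlow

/-! ### Growth of the negative log-loss along the flow -/

namespace MarginFlow

variable {p m : ℕ} {F : Fin m → (Fin p → ℝ) → ℝ} {L : ℝ} {η : ℝ → ℝ} {θ U : ℝ → Fin p → ℝ}
  {C : ℝ} {w : Fin p → ℝ} {γ : ℝ} {φ : ℝ → ℝ} {g : ℝ → Fin p → ℝ}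

lemma mul_expLoss_le_scale {t κ : ℝ}
    (hκ : ∀ i, κ ≤ deriv φ (F i (θ t))) :
    κ * ‖θ t‖ ^ (L - 1) * expLoss φ F (θ t) ≤ scale φ F L θ t := by
  rw [expLoss, Finset.mul_sum, scale]
  refine Finset.sum_le_sum fun i _ => ?_
  have h1 : 0 ≤ ‖θ t‖ ^ (L - 1) := Real.rpow_nonneg (norm_nonneg _) _
  have h2 := mul_le_mul_of_nonneg_right (hκ i)
    (mul_nonneg h1 (Real.exp_pos (-φ (F i (θ t)))).le)
  rw [weight, lossWeight]
  linarith

lemma neg_log_expLoss_le [NeZero m] (i : Fin m) (ϑ : Fin p → ℝ) :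
    -Real.log (expLoss φ F ϑ) ≤ φ (F i ϑ) := by
  have h1 : Real.exp (-φ (F i ϑ)) ≤ expLoss φ F ϑ :=
    Finset.single_le_sum (f := fun i => Real.exp (-φ (F i ϑ))) (fun _ _ => (Real.exp_pos _).le)
      (Finset.mem_univ i)
  have h2 := Real.log_le_log (Real.exp_pos _) h1
  rw [Real.log_exp] at h2
  linarith

variable (h : MarginFlow F L η θ U C w γ) (hφ : IsLossExponent φ)

include h

lemma integral_rate_eq {a b : ℝ} (ha : 0 ≤ a) (hab : a ≤ b) :
    ∫ t in a..b, η t = (∫ t in (0 : ℝ)..b, η t) - ∫ t in (0 : ℝ)..a, η t := by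
  have hi : ∀ c, 0 ≤ c → IntervalIntegrable η volume 0 c := fun c hc =>
    (h.rate_anti.mono fun x hx => by
      rw [Set.uIcc_of_le hc] at hx; exact hx.1).intervalIntegrable
  rw [intervalIntegral.integral_interval_sub_left (hi b (ha.trans hab)) (hi a ha)]

include hφ

/-- Growth of a decreasing function `ψ` of the loss along the flow. -/
lemma mul_integral_rate_le (hg : ∀ t, 0 ≤ t → g t = gradVec (expLoss φ F) (θ t))
    {ψ ψ' : ℝ → ℝ} {a b c : ℝ} (ha : 0 < a) (hab : a ≤ b)
    (hψ : ∀ t ∈ Set.Icc a b, ContDiffAt ℝ 1 ψ (expLoss φ F (θ t)))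
    (hψ' : ∀ t ∈ Set.Icc a b, HasDerivAt ψ (ψ' t) (expLoss φ F (θ t)))
    (hc : ∀ t ∈ Set.Icc a b, c ≤ -ψ' t * ∑ j, U t j * g t j) :
    c * ∫ t in a..b, η t ≤ ψ (expLoss φ F (θ b)) - ψ (expLoss φ F (θ a)) := by
  have hℓ := contDiff_expLoss hφ h.contDiff
  obtain ⟨hi, heq⟩ := h.ftc (fun ϑ => ψ (expLoss φ F ϑ)) a b ha hab
    fun t ht => (hψ t ht).comp (θ t) hℓ.contDiffAt
  rw [heq, ← intervalIntegral.integral_const_mul, ← intervalIntegral.integral_neg]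
  have hηi : IntervalIntegrable η volume a b :=
    (h.rate_anti.mono fun x hx => by
      rw [Set.uIcc_of_le hab] at hx; exact ha.le.trans hx.1).intervalIntegrable
  refine intervalIntegral.integral_mono_on hab (hηi.const_mul c) hi.neg fun t ht => ?_
  have ht0 : 0 ≤ t := ha.le.trans ht.1
  have h1 : ∑ j, U t j * gradVec (fun ϑ => ψ (expLoss φ F ϑ)) (θ t) j
      = ψ' t * ∑ j, U t j * g t j := by
    rw [Finset.mul_sum]
    refine Finset.sum_congr rfl fun j _ => ?_
    rw [gradVec_comp (hψ' t ht) (hℓ.differentiable one_ne_zero _), hg t ht0]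
    ring
  rw [h1]
  have h2 := mul_le_mul_of_nonneg_left (hc t ht) (h.rate_pos t ht0).le
  linarith

variable [NeZero m] {ε : ℝ}

/-- Descent faster than a constant rate forces the norm to diverge. -/
lemma tendsto_norm_rpow_atTop (hg : ∀ t, 0 ≤ t → g t = gradVec (expLoss φ F) (θ t))
    (hS : Tendsto (fun T : ℝ => ∫ t in (0 : ℝ)..T, η t) atTop atTop) {c : ℝ} (hc : 0 < c)
    (hdesc : ∀ᶠ t in atTop, c * scale φ F L θ t ≤ ∑ j, U t j * g t j) :
    Tendsto (fun t => ‖θ t‖ ^ L) atTop atTop := by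
  obtain ⟨N, hN, hlow⟩ := h.lower
  set c₁ := c * (deriv φ 0 * N ^ (L - 1)) with hc₁
  have hφ0 := hφ.deriv_pos 0
  have hN' : 0 < N ^ (L - 1) := Real.rpow_pos_of_pos hN _
  have hc₁0 : 0 < c₁ := by positivity
  obtain ⟨T₀, hT₀⟩ := eventually_atTop.1 (hdesc.and (hlow.and h.eventually_value_pos))
  set T := max T₀ 1 with hT
  have hT0 : 0 < T := by positivity
  set ℓ : ℝ → ℝ := fun t => expLoss φ F (θ t) with hℓ
  have hpos : ∀ t, 0 < ℓ t := fun t => expLoss_pos _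
  -- The scale dominates a fixed multiple of the loss, so `-log ℓ` grows at least linearly in `∫ η`;
  -- in turn `-log ℓ` is at most affine in `‖θ‖ ^ L`.
  have hgrow : ∀ t, T ≤ t → c₁ * ∫ s in T..t, η s ≤ -Real.log (ℓ t) - -Real.log (ℓ T) := by
    intro t ht
    refine h.mul_integral_rate_le hφ hg (ψ := fun u => -Real.log u) (ψ' := fun s => -(ℓ s)⁻¹)
      hT0 ht (fun s _ => (Real.contDiffAt_log.2 (hpos s).ne').neg)
      (fun s _ => (Real.hasDerivAt_log (hpos s).ne').neg) fun s hs => ?_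
    obtain ⟨h1, h2, h3⟩ := hT₀ s ((le_max_left _ _).trans hs.1)
    have h4 : deriv φ 0 * ‖θ s‖ ^ (L - 1) * ℓ s ≤ scale φ F L θ s :=
      mul_expLoss_le_scale fun i => hφ.monotone_deriv (h3 i).le
    have h5 : N ^ (L - 1) ≤ ‖θ s‖ ^ (L - 1) :=
      Real.rpow_le_rpow hN.le h2 (by linarith [h.one_le])
    rw [neg_neg, inv_mul_eq_div, le_div_iff₀ (hpos s)]
    calc c₁ * ℓ s = c * (deriv φ 0 * N ^ (L - 1) * ℓ s) := by rw [hc₁]; ring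
      _ ≤ c * (deriv φ 0 * ‖θ s‖ ^ (L - 1) * ℓ s) := by
        have := (hpos s).le
        gcongr
      _ ≤ c * scale φ F L θ s := mul_le_mul_of_nonneg_left h4 hc.le
      _ ≤ _ := h1
  have hκ := hφ.iSup_pos
  set κ := ⨆ v, deriv φ v with hκdef
  set i₀ : Fin m := 0
  have hFw : 0 < F i₀ w := h.margin_pos.trans_le (h.margin_le i₀)
  have hE : 0 < κ * (F i₀ w + 1) := by positivity
  have hlim : Tendsto (fun t => (c₁ * ((∫ s in (0 : ℝ)..t, η s) - ∫ s in (0 : ℝ)..T, η s)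
      + -Real.log (ℓ T) - φ 0) / (κ * (F i₀ w + 1))) atTop atTop := by
    refine Tendsto.atTop_div_const hE ?_
    refine tendsto_atTop_add_const_right _ _ (tendsto_atTop_add_const_right _ _ ?_)
    exact (tendsto_atTop_add_const_right _ _ hS).const_mul_atTop hc₁0
  refine tendsto_atTop_mono' _ ?_ hlim
  filter_upwards [eventually_ge_atTop T, h.eventually_norm_pos, h.eventually_value_pos,
    (h.tendsto_value i₀).eventually_lt_const (lt_add_one _)] with t h1 h2 h3 h4
  rw [div_le_iff₀ hE, ← h.integral_rate_eq hT0.le h1]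
  have h5 := hgrow t h1
  have h6 : -Real.log (ℓ t) ≤ φ (F i₀ (θ t)) := neg_log_expLoss_le i₀ (θ t)
  have h7 := hφ.le_add_mul (h3 i₀).le
  have h8 : F i₀ (θ t) ≤ ‖θ t‖ ^ L * (F i₀ w + 1) := by
    rw [h.value_eq h2]
    exact mul_le_mul_of_nonneg_left h4.le (Real.rpow_nonneg h2.le _)
  have h9 := mul_le_mul_of_nonneg_left h8 hκ.le
  calc _ ≤ κ * F i₀ (θ t) := by linarith
    _ ≤ _ := h9
    _ = _ := by ring

/-- If the norm grows at most like `∫ η`, the descent rate cannot exceed `L γ`, with `γ` the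
margin of the limit direction. -/
lemma not_eventually_descent (hg : ∀ t, 0 ≤ t → g t = gradVec (expLoss φ F) (θ t))
    (hS : Tendsto (fun T : ℝ => ∫ t in (0 : ℝ)..T, η t) atTop atTop) {K : ℝ}
    (hgrow : ∀ᶠ t in atTop, ‖θ t‖ ≤ (∫ s in (0 : ℝ)..t, η s) + K)
    {i₀ : Fin m} (hi₀ : F i₀ w = γ) (hε : 0 < ε)
    (hdesc : ∀ᶠ t in atTop, (L * γ + ε) * scale φ F L θ t ≤ ∑ j, U t j * g t j) : False := by
  have hL := h.one_le
  have hL0 : 0 < L := by linarith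
  have hγ := h.margin_pos
  have hrate : 0 < L * γ + ε := by positivity
  have hρ := h.tendsto_norm_rpow_atTop hφ hg hS hrate hdesc
  have hκ := hφ.iSup_pos
  set κ := ⨆ v, deriv φ v with hκdef
  -- Small enough for `L * (γ + 2 * δ) < (1 - δ) * (L * γ + ε)`. One `δ` covers `F i₀` near its
  -- limit, the second absorbs the constant `φ 0`, and `1 - δ` is the loss in `φ' ≥ (1 - δ) * κ`.
  set δ := ε / 2 / (2 * L + L * γ + ε) with hδ
  have hδ0 : 0 < δ := by positivity
  have hδeq : δ * (2 * L + L * γ + ε) = ε / 2 := by rw [hδ]; field_simp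
  have hδ1 : δ < 1 := by rw [hδ, div_lt_one (by positivity)]; nlinarith [mul_pos hL0 hγ]
  have hkey : L * (γ + 2 * δ) < (1 - δ) * (L * γ + ε) := by nlinarith
  set Γ := κ * (γ + 2 * δ) with hΓ
  have hΓ0 : 0 < Γ := by positivity
  -- The lower bound for the derivative of `(-log ℓ) ^ (1 / L)` with respect to `∫ η`; it exceeds `Γ
  -- ^ (1 / L)`, the largest rate compatible with the norm growth.
  set c := 1 / L * Γ ^ (1 / L - 1) * ((1 - δ) * κ * (L * γ + ε)) with hc
  have hcΓ : Γ ^ (1 / L) < c := by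
    have h1 : Γ ^ (1 / L) = Γ ^ (1 / L - 1) * Γ := by
      rw [← Real.rpow_add_one hΓ0.ne', sub_add_cancel]
    have h2 : 0 < Γ ^ (1 / L - 1) := Real.rpow_pos_of_pos hΓ0 _
    rw [h1, hc, show 1 / L * Γ ^ (1 / L - 1) * ((1 - δ) * κ * (L * γ + ε))
      = Γ ^ (1 / L - 1) * (κ * ((1 - δ) * (L * γ + ε)) / L) by ring]
    refine mul_lt_mul_of_pos_left ?_ h2
    rw [lt_div_iff₀ hL0, hΓ]
    calc κ * (γ + 2 * δ) * L = κ * (L * (γ + 2 * δ)) := by ring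
      _ < _ := mul_lt_mul_of_pos_left hkey hκ
  set ℓ : ℝ → ℝ := fun t => expLoss φ F (θ t) with hℓ
  have hpos : ∀ t, 0 < ℓ t := fun t => expLoss_pos _
  obtain ⟨q₀, hq₀⟩ := hφ.exists_le_deriv hδ0
  have hq : ∀ᶠ t in atTop, ∀ i, q₀ ≤ F i (θ t) := by
    filter_upwards [h.eventually_value_ge, (hρ.const_mul_atTop (half_pos hγ)).eventually_ge_atTop q₀]
      with t h1 h2 i using h2.trans (h1 i)
  have hMpos : ∀ᶠ t in atTop, 0 < -Real.log (ℓ t) := by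
    have h1 : Tendsto (fun t => Real.log m + -(φ 0 + deriv φ 0 * (γ / 2 * ‖θ t‖ ^ L))) atTop
        atBot := by
      refine tendsto_atBot_add_const_left _ _ (tendsto_neg_atTop_atBot.comp ?_)
      exact tendsto_atTop_add_const_left _ _
        ((hρ.const_mul_atTop (half_pos hγ)).const_mul_atTop (hφ.deriv_pos 0))
    filter_upwards [h1.eventually_lt_atBot 0, h.eventually_value_ge, h.eventually_value_pos]
      with t h2 h3 h4
    have h5 : ℓ t ≤ m * Real.exp (-(φ 0 + deriv φ 0 * (γ / 2 * ‖θ t‖ ^ L))) := by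
      have h6 : ∀ i, Real.exp (-φ (F i (θ t)))
          ≤ Real.exp (-(φ 0 + deriv φ 0 * (γ / 2 * ‖θ t‖ ^ L))) := by
        intro i
        refine Real.exp_le_exp.2 (neg_le_neg (le_trans ?_ (hφ.add_mul_le (h4 i).le)))
        have := mul_le_mul_of_nonneg_left (h3 i) (hφ.deriv_pos 0).le
        linarith
      have h7 := Finset.sum_le_sum fun i (_ : i ∈ Finset.univ) => h6 i
      rw [Finset.sum_const, Finset.card_univ, Fintype.card_fin, nsmul_eq_mul] at h7
      exact h7
    have hm0 : (0 : ℝ) < m := Nat.cast_pos.2 (NeZero.pos m)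
    have h6 := Real.log_le_log (hpos t) h5
    rw [Real.log_mul hm0.ne' (Real.exp_pos _).ne', Real.log_exp] at h6
    linarith
  have hMle : ∀ᶠ t in atTop, -Real.log (ℓ t) ≤ Γ * ‖θ t‖ ^ L := by
    have h1 : F i₀ w < γ + δ := by linarith
    filter_upwards [h.eventually_norm_pos, h.eventually_value_pos,
      (h.tendsto_value i₀).eventually_lt_const h1,
      (hρ.const_mul_atTop (mul_pos hκ hδ0)).eventually_ge_atTop (φ 0)] with t h2 h3 h4 h5
    have h6 : -Real.log (ℓ t) ≤ φ (F i₀ (θ t)) := neg_log_expLoss_le i₀ (θ t)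
    have h7 := hφ.le_add_mul (h3 i₀).le
    have h8 : F i₀ (θ t) ≤ ‖θ t‖ ^ L * (γ + δ) := by
      rw [h.value_eq h2]
      exact mul_le_mul_of_nonneg_left h4.le (Real.rpow_nonneg h2.le _)
    have h9 := mul_le_mul_of_nonneg_left h8 hκ.le
    rw [hΓ]
    linarith
  obtain ⟨T₀, hT₀⟩ := eventually_atTop.1
    (((hdesc.and hq).and (hMpos.and hMle)).and (h.eventually_norm_pos.and hgrow))
  set T := max T₀ 1 with hT
  have hT0 : 0 < T := by positivity
  have hP : ∀ t, T ≤ t → c * ∫ s in T..t, η s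
      ≤ (-Real.log (ℓ t)) ^ (1 / L) - (-Real.log (ℓ T)) ^ (1 / L) := by
    intro t ht
    have hM0 : ∀ s ∈ Set.Icc T t, 0 < -Real.log (ℓ s) := fun s hs =>
      (hT₀ s ((le_max_left _ _).trans hs.1)).1.2.1
    refine h.mul_integral_rate_le hφ hg (ψ := fun u => (-Real.log u) ^ (1 / L))
      (ψ' := fun s => -(ℓ s)⁻¹ * (1 / L) * (-Real.log (ℓ s)) ^ (1 / L - 1)) hT0 ht
      (fun s hs => ?_) (fun s hs => ?_) fun s hs => ?_
    · exact ((Real.contDiffAt_log.2 (hpos s).ne').neg).rpow_const_of_ne (hM0 s hs).ne'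
    · exact ((Real.hasDerivAt_log (hpos s).ne').neg).rpow_const (Or.inl (hM0 s hs).ne')
    · obtain ⟨⟨⟨h1, h2⟩, h3, h4⟩, h5, -⟩ := hT₀ s ((le_max_left _ _).trans hs.1)
      have h6 : (1 - δ) * κ * ‖θ s‖ ^ (L - 1) * ℓ s ≤ scale φ F L θ s :=
        mul_expLoss_le_scale fun i => hq₀ _ (h2 i)
      have h7 : (L * γ + ε) * ((1 - δ) * κ * ‖θ s‖ ^ (L - 1)) ≤
          (ℓ s)⁻¹ * ∑ j, U s j * g s j := by
        rw [inv_mul_eq_div, le_div_iff₀ (hpos s), mul_assoc]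
        exact (mul_le_mul_of_nonneg_left h6 hrate.le).trans h1
      -- The exponent `1 / L - 1` is nonpositive, so the upper bound on `-log ℓ` gives a lower bound
      -- here, and its power of `‖θ‖` cancels the one in the scale.
      have h8 : Γ ^ (1 / L - 1) * ‖θ s‖ ^ (1 - L) ≤ (-Real.log (ℓ s)) ^ (1 / L - 1) := by
        have h9 : (Γ * ‖θ s‖ ^ L) ^ (1 / L - 1) ≤ (-Real.log (ℓ s)) ^ (1 / L - 1) := by
          refine Real.rpow_le_rpow_of_nonpos h3 h4 ?_
          rw [sub_nonpos, div_le_one hL0]; exact hL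
        refine le_trans (le_of_eq ?_) h9
        rw [Real.mul_rpow hΓ0.le (Real.rpow_nonneg h5.le _), ← Real.rpow_mul h5.le]
        congr 2
        field_simp
      have h10 : ‖θ s‖ ^ (1 - L) * ‖θ s‖ ^ (L - 1) = 1 := by
        rw [← Real.rpow_add h5]; simp
      have h11 : 0 < Γ ^ (1 / L - 1) := Real.rpow_pos_of_pos hΓ0 _
      have h12 : 0 < ‖θ s‖ ^ (1 - L) := Real.rpow_pos_of_pos h5 _
      have h13 : 0 < ‖θ s‖ ^ (L - 1) := Real.rpow_pos_of_pos h5 _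
      have h14 : 0 ≤ 1 - δ := by linarith
      calc c = 1 / L * ((Γ ^ (1 / L - 1) * ‖θ s‖ ^ (1 - L)) *
            ((L * γ + ε) * ((1 - δ) * κ * ‖θ s‖ ^ (L - 1)))) := by
            rw [hc]
            linear_combination (-(1 / L * Γ ^ (1 / L - 1) * ((1 - δ) * κ * (L * γ + ε)))) * h10
        _ ≤ 1 / L * ((-Real.log (ℓ s)) ^ (1 / L - 1) * ((ℓ s)⁻¹ * ∑ j, U s j * g s j)) := by
            refine mul_le_mul_of_nonneg_left ?_ (by positivity)
            exact mul_le_mul h8 h7 (by positivity) (Real.rpow_nonneg h3.le _)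
        _ = _ := by ring
  have hbound : ∀ᶠ t in atTop, (c - Γ ^ (1 / L)) * (∫ s in (0 : ℝ)..t, η s) ≤
      c * (∫ s in (0 : ℝ)..T, η s) + Γ ^ (1 / L) * K := by
    filter_upwards [eventually_ge_atTop T] with t ht
    obtain ⟨⟨-, h3, h4⟩, h5, h6⟩ := hT₀ t ((le_max_left _ _).trans ht)
    have h7 := hP t ht
    rw [h.integral_rate_eq hT0.le ht] at h7
    have h8 : (-Real.log (ℓ t)) ^ (1 / L) ≤ Γ ^ (1 / L) * ‖θ t‖ := by
      have h9 := Real.rpow_le_rpow h3.le h4 (by positivity : 0 ≤ 1 / L)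
      rwa [Real.mul_rpow hΓ0.le (Real.rpow_nonneg h5.le _), ← Real.rpow_mul h5.le,
        mul_one_div_cancel hL0.ne', Real.rpow_one] at h9
    have h10 := mul_le_mul_of_nonneg_left h6 (Real.rpow_nonneg hΓ0.le (1 / L))
    have h11 : 0 ≤ (-Real.log (ℓ T)) ^ (1 / L) :=
      Real.rpow_nonneg (hT₀ T (le_max_left _ _)).1.2.1.le _
    linarith
  have hdiv := (hS.const_mul_atTop (sub_pos.2 hcΓ)).eventually_gt_atTop
    (c * (∫ s in (0 : ℝ)..T, η s) + Γ ^ (1 / L) * K)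
  obtain ⟨t, h1, h2⟩ := (hbound.and hdiv).exists
  linarith

/-- Under the growth bound, some convex combination of the gradients at the limit direction has
`ℓ¹` norm at most `L γ`. -/
lemma exists_sum_abs_le (hg : ∀ t, 0 ≤ t → g t = gradVec (expLoss φ F) (θ t))
    (hS : Tendsto (fun T : ℝ => ∫ t in (0 : ℝ)..T, η t) atTop atTop) {K : ℝ}
    (hgrow : ∀ᶠ t in atTop, ‖θ t‖ ≤ (∫ s in (0 : ℝ)..t, η s) + K)
    {i₀ : Fin m} (hi₀ : F i₀ w = γ)
    (hdesc : ∀ ε, 0 < ε → ∀ᶠ t in atTop,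
      (∑ j, |∑ i, weight φ F L θ i t * gradVec (F i) w j|) - ε * scale φ F L θ t
        ≤ ∑ j, U t j * g t j) :
    ∃ l : Fin m → ℝ, (∀ i, 0 ≤ l i) ∧ ∑ i, l i = 1 ∧
      ∑ j, |∑ i, l i * gradVec (F i) w j| ≤ L * γ := by
  by_contra! hcon
  have hcont : Continuous fun l : Fin m → ℝ => ∑ j, |∑ i, l i * gradVec (F i) w j| := by
    fun_prop
  -- A minimizer over the simplex turns the pointwise strict inequality into a uniform gap `ε`,
  -- which applies to the normalized weights at every large time.
  obtain ⟨l₀, hl₀, hmin⟩ := (isCompact_stdSimplex ℝ (Fin m)).exists_isMinOn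
    ⟨_, single_mem_stdSimplex ℝ i₀⟩ hcont.continuousOn
  set ε := (∑ j, |∑ i, l₀ i * gradVec (F i) w j|) - L * γ with hε
  have hε0 : 0 < ε := sub_pos.2 (hcon l₀ hl₀.1 hl₀.2)
  refine h.not_eventually_descent hφ hg hS hgrow hi₀ (half_pos hε0) ?_
  filter_upwards [hdesc (ε / 2) (half_pos hε0), h.eventually_norm_pos] with t h1 h2
  have hA : 0 < scale φ F L θ t := scale_pos hφ h2
  have hmem : (fun i => weight φ F L θ i t / scale φ F L θ t) ∈ stdSimplex ℝ (Fin m) := by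
    refine ⟨fun i => div_nonneg (weight_pos hφ h2 i).le hA.le, ?_⟩
    rw [← Finset.sum_div]
    exact div_self hA.ne'
  have h3 : ∑ j, |∑ i, l₀ i * gradVec (F i) w j| ≤
      ∑ j, |∑ i, weight φ F L θ i t / scale φ F L θ t * gradVec (F i) w j| := hmin hmem
  have h4 : ∑ j, |∑ i, weight φ F L θ i t * gradVec (F i) w j| = scale φ F L θ t *
      ∑ j, |∑ i, weight φ F L θ i t / scale φ F L θ t * gradVec (F i) w j| := by
    rw [Finset.mul_sum]
    refine Finset.sum_congr rfl fun j _ => ?_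
    rw [← abs_of_pos hA, ← abs_mul, abs_of_pos hA, Finset.mul_sum]
    congr 1
    refine Finset.sum_congr rfl fun i _ => ?_
    field_simp
  have h5 := mul_le_mul_of_nonneg_left h3 hA.le
  rw [← h4] at h5
  have h6 : ∑ j, |∑ i, l₀ i * gradVec (F i) w j| = L * γ + ε := by rw [hε]; ring
  rw [h6] at h5
  linarith

end MarginFlow

/-! ### The Adam direction -/

/-- Jensen bounds the squared numerator, and since `c₂ ≤ c₁` the ratio of the two bias corrections
is at most `1` and can be dropped. -/
lemma sq_adam_direction_le {c₁ c₂ t : ℝ} (hc₂ : 0 < c₂) (hc : c₂ ≤ c₁) (ht : 0 < t) {h : ℝ → ℝ}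
    (hh : Continuous h) (hv : 0 < ema c₂ (fun s => h s ^ 2) t) :
    (emaHat c₁ h t / Real.sqrt (emaHat c₂ (fun s => h s ^ 2) t)) ^ 2 ≤
      ema c₁ (fun s => h s ^ 2) t / ema c₂ (fun s => h s ^ 2) t := by
  have hc₁ : 0 < c₁ := hc₂.trans_le hc
  have he₁ := one_sub_exp_pos hc₁ ht
  have he₂ := one_sub_exp_pos hc₂ ht
  have hle : 1 - Real.exp (-c₂ * t) ≤ 1 - Real.exp (-c₁ * t) :=
    sub_le_sub_left (Real.exp_le_exp.2 (by nlinarith)) _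
  have hvhat : 0 < emaHat c₂ (fun s => h s ^ 2) t := mul_pos (inv_pos.2 he₂) hv
  have hn : 0 ≤ ema c₁ (fun s => h s ^ 2) t :=
    intervalIntegral.integral_nonneg ht.le fun s _ => by positivity
  rw [div_pow, Real.sq_sqrt hvhat.le, div_le_div_iff₀ hvhat hv]
  have h1 := sq_emaHat_le hc₁ ht hh
  refine (mul_le_mul_of_nonneg_right h1 hv.le).trans ?_
  rw [emaHat, emaHat, mul_right_comm, mul_comm (ema c₁ _ t), mul_assoc, mul_assoc,
    mul_comm (ema c₂ _ t)]
  exact mul_le_mul_of_nonneg_right (inv_anti₀ he₂ hle) (mul_nonneg hn hv.le)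

lemma continuousOn_emaHat {c : ℝ} (hc : 0 < c) {h : ℝ → ℝ} (hh : Continuous h) :
    ContinuousOn (emaHat c h) (Set.Ioi 0) := by
  refine ContinuousOn.mul (ContinuousOn.inv₀ (by fun_prop) fun t ht =>
    (one_sub_exp_pos hc ht).ne') (continuous_ema hh c).continuousOn

/-- Otherwise continuity would give `h < ρ` on an interval of positive measure to the right of `0`.
-/
lemma pos_of_ae_lt {h : ℝ → ℝ} (hh : Continuous h) {τ ρ : ℝ} (hτ : 0 < τ) (hρ : 0 < ρ)
    (hae : ∀ᵐ t ∂(volume.restrict (Set.Icc (0 : ℝ) τ)), ρ < h t) : 0 < h 0 := by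
  by_contra! hcon
  have h1 : ∀ᶠ t in 𝓝 (0 : ℝ), h t < ρ := hh.continuousAt.eventually_lt_const (hcon.trans_lt hρ)
  obtain ⟨r, hr, h2⟩ := Metric.eventually_nhds_iff.1 h1
  rw [ae_restrict_iff' measurableSet_Icc, ae_iff] at hae
  have h3 : Set.Ioo 0 (min r τ) ⊆ {t | ¬(t ∈ Set.Icc 0 τ → ρ < h t)} := by
    intro t ht hcontra
    have ht1 : t < r := ht.2.trans_le (min_le_left _ _)
    have h4 : h t < ρ := h2 (by rw [Real.dist_eq, sub_zero, abs_of_pos ht.1]; exact ht1)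
    exact (hcontra ⟨ht.1.le, (ht.2.trans_le (min_le_right _ _)).le⟩).not_gt h4
  have h4 := measure_mono_null h3 hae
  rw [Real.volume_Ioo, sub_zero, ENNReal.ofReal_eq_zero] at h4
  exact (lt_min hr hτ).not_ge h4

/-! ### Bounds on the weights, the gradient and the norm -/

namespace MarginFlow

variable {p m : ℕ} {F : Fin m → (Fin p → ℝ) → ℝ} {L : ℝ} {η : ℝ → ℝ} {θ U : ℝ → Fin p → ℝ}
  {C : ℝ} {w : Fin p → ℝ} {γ : ℝ} {φ : ℝ → ℝ}

/-- The loss factor decays exponentially in `‖θ‖ ^ L`, which beats the factor `‖θ‖ ^ (L - 1)`; the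
norm is not assumed to diverge. -/
lemma exists_weight_le (h : MarginFlow F L η θ U C w γ) (hφ : IsLossExponent φ) :
    ∃ B, 0 ≤ B ∧ ∀ᶠ t in atTop, ∀ i, weight φ F L θ i t ≤ B := by
  have hκ := hφ.iSup_pos
  have hL := h.one_le
  set κ := ⨆ v, deriv φ v with hκdef
  set β := deriv φ 0 * (γ / 2) with hβ
  have hβ0 : 0 < β := mul_pos (hφ.deriv_pos 0) (half_pos h.margin_pos)
  refine ⟨κ * Real.exp (-φ 0) * (1 + 1 / β), by positivity, ?_⟩
  filter_upwards [h.eventually_norm_pos, h.eventually_value_ge, h.eventually_value_pos]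
    with t h1 h2 h3 i
  set X := ‖θ t‖ ^ L with hX
  have hX0 : 0 < X := Real.rpow_pos_of_pos h1 _
  have h4 : ‖θ t‖ ^ (L - 1) ≤ 1 + X := by
    rcases le_total ‖θ t‖ 1 with h5 | h5
    · have := Real.rpow_le_one h1.le h5 (by linarith : 0 ≤ L - 1)
      linarith
    · have := Real.rpow_le_rpow_of_exponent_le h5 (by linarith : L - 1 ≤ L)
      linarith
  have h5 : Real.exp (-φ (F i (θ t))) ≤ Real.exp (-φ 0) * Real.exp (-(β * X)) := by
    rw [← Real.exp_add]
    refine Real.exp_le_exp.2 ?_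
    have h6 := hφ.add_mul_le (h3 i).le
    have h7 := mul_le_mul_of_nonneg_left (h2 i) (hφ.deriv_pos 0).le
    rw [hβ]
    linarith
  have h6 : Real.exp (-(β * X)) * (1 + X) ≤ 1 + 1 / β := by
    rw [Real.exp_neg, inv_mul_eq_div, div_le_iff₀ (Real.exp_pos _)]
    have h7 : 1 ≤ Real.exp (β * X) := Real.one_le_exp (by positivity)
    have h8 : X ≤ 1 / β * Real.exp (β * X) := by
      rw [one_div, inv_mul_eq_div, le_div_iff₀ hβ0]
      linarith [Real.add_one_le_exp (β * X)]
    linarith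
  calc weight φ F L θ i t
      = Real.exp (-φ (F i (θ t))) * deriv φ (F i (θ t)) * ‖θ t‖ ^ (L - 1) := rfl
    _ ≤ (Real.exp (-φ 0) * Real.exp (-(β * X))) * κ * (1 + X) := by
        have := hφ.deriv_le_iSup (F i (θ t))
        have := (hφ.deriv_pos (F i (θ t))).le
        gcongr
    _ = κ * Real.exp (-φ 0) * (Real.exp (-(β * X)) * (1 + X)) := by ring
    _ ≤ _ := mul_le_mul_of_nonneg_left h6 (by positivity)

/-- Supplies the uniform bound on `g²` that makes the potential of `exists_ema_potential` bounded
above. -/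
lemma exists_gradVec_expLoss_le (h : MarginFlow F L η θ U C w γ) (hφ : IsLossExponent φ) :
    ∃ B, ∀ t, 0 ≤ t → ∀ j, |gradVec (expLoss φ F) (θ t) j| ≤ B := by
  obtain ⟨B, hB, h1⟩ := h.exists_weight_le hφ
  obtain ⟨K, hK, -, h2⟩ := h.exists_gradVec_bound
  obtain ⟨T, hT⟩ := eventually_atTop.1 ((h1.and h2).and h.eventually_norm_pos)
  have hcont : ContinuousOn (fun t => gradVec (expLoss φ F) (θ t)) (Set.Icc 0 T) :=
    (continuous_gradVec (contDiff_expLoss hφ h.contDiff)).comp_continuousOn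
      (h.continuousOn.mono fun _ ht => ht.1)
  obtain ⟨D, hD⟩ := isCompact_Icc.exists_bound_of_continuousOn hcont
  refine ⟨max D (m * (B * K)), fun t ht j => ?_⟩
  rcases le_total t T with htT | hTt
  · exact ((norm_le_pi_norm (gradVec (expLoss φ F) (θ t)) j).trans (hD t ⟨ht, htT⟩)).trans
      (le_max_left _ _)
  · obtain ⟨⟨h3, h4⟩, h5⟩ := hT t hTt
    refine le_trans ?_ (le_max_right _ _)
    rw [h.gradVec_expLoss_eq hφ h5, abs_neg]
    refine (Finset.abs_sum_le_sum_abs _ _).trans ?_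
    have h6 : ∀ i ∈ Finset.univ,
        |weight φ F L θ i t * gradVec (F i) (‖θ t‖⁻¹ • θ t) j| ≤ B * K := by
      intro i _
      rw [abs_mul, abs_of_pos (weight_pos hφ h5 i)]
      exact mul_le_mul (h3 i) (h4 i j) (abs_nonneg _) hB
    have h7 := Finset.sum_le_sum h6
    rwa [Finset.sum_const, Finset.card_univ, Fintype.card_fin, nsmul_eq_mul] at h7

/-- If the direction is bounded by `1 + Ψ'` with `Ψ` bounded above, then the norm grows at most
like `∫ η`. -/
lemma exists_norm_le_integral_rate (h : MarginFlow F L η θ U C w γ) {Ψ Ψ' : Fin p → ℝ → ℝ}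
    {K : Fin p → ℝ} (hΨ : ∀ j t, 0 < t → HasDerivAt (Ψ j) (Ψ' j t) t)
    (hΨ' : ∀ j, ContinuousOn (Ψ' j) (Set.Ioi 0)) (hK : ∀ j t, 0 < t → Ψ j t ≤ K j)
    (hU : ∀ j t, 0 < t → |U t j| ≤ 1 + Ψ' j t) :
    ∃ D, ∀ᶠ t in atTop, ‖θ t‖ ≤ (∫ s in (0 : ℝ)..t, η s) + D := by
  -- Integration starts at time `1` because the potentials are controlled only on `(0, ∞)`.
  have hη1 : 0 < η 1 := h.rate_pos 1 zero_le_one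
  set D : Fin p → ℝ := fun j => |θ 1 j| + η 1 * (K j - Ψ j 1) with hD
  have hD0 : ∀ j, 0 ≤ D j := fun j =>
    add_nonneg (abs_nonneg _) (mul_nonneg hη1.le (sub_nonneg.2 (hK j 1 one_pos)))
  refine ⟨∑ j, D j, ?_⟩
  filter_upwards [eventually_ge_atTop 1] with t ht
  have hsub : Set.Icc 1 t ⊆ Set.Ioi 0 := fun x hx => zero_lt_one.trans_le hx.1
  have hS0 : ∀ t, 0 ≤ t → 0 ≤ ∫ s in (0 : ℝ)..t, η s := fun t ht =>
    intervalIntegral.integral_nonneg ht fun s hs => (h.rate_pos s hs.1).le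
  have hanti : AntitoneOn η (Set.Icc 1 t) :=
    h.rate_anti.mono fun x hx => zero_le_one.trans hx.1
  have hηi : IntervalIntegrable η volume 1 t :=
    AntitoneOn.intervalIntegrable (by rwa [Set.uIcc_of_le ht])
  refine (pi_norm_le_iff_of_nonneg (add_nonneg (hS0 t (by linarith))
    (Finset.sum_nonneg fun j _ => hD0 j))).2 fun j => ?_
  have hΨi : IntervalIntegrable (fun s => η s * Ψ' j s) volume 1 t :=
    hηi.mul_continuousOn (by rw [Set.uIcc_of_le ht]; exact (hΨ' j).mono hsub)
  have h1 := (h.ftc (fun ϑ => ϑ j) 1 t one_pos ht fun t _ =>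
    (contDiff_apply ℝ ℝ j).contDiffAt).2
  simp only [gradVec_proj, mul_ite, mul_one, mul_zero, Finset.sum_ite_eq, Finset.mem_univ,
    if_true] at h1
  have h2 : |θ t j - θ 1 j| ≤ ∫ s in (1 : ℝ)..t, (η s + η s * Ψ' j s) := by
    rw [h1, abs_neg, ← Real.norm_eq_abs]
    refine intervalIntegral.norm_integral_le_of_norm_le (μ := volume) ht
      (Eventually.of_forall fun s hs => ?_) (hηi.add hΨi)
    have hs0 : 0 < s := zero_lt_one.trans hs.1
    rw [norm_mul, Real.norm_of_nonneg (h.rate_pos s hs0.le).le]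
    calc η s * ‖U s j‖ ≤ η s * (1 + Ψ' j s) :=
          mul_le_mul_of_nonneg_left (hU j s hs0) (h.rate_pos s hs0.le).le
      _ = _ := by ring
  rw [intervalIntegral.integral_add hηi hΨi, h.integral_rate_eq zero_le_one ht] at h2
  have h3 : ∫ s in (1 : ℝ)..t, η s * Ψ' j s ≤ η 1 * (K j - Ψ j 1) :=
    integral_antitone_mul_deriv_le ht hanti (h.rate_pos t (by linarith)).le
      (fun x hx => hΨ j x (hsub hx)) ((hΨ' j).mono hsub) fun x hx => hK j x (hsub hx)
  have h4 : D j ≤ ∑ j, D j :=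
    Finset.single_le_sum (f := D) (fun j _ => hD0 j) (Finset.mem_univ j)
  have h5 : |θ t j| ≤ |θ t j - θ 1 j| + |θ 1 j| := by
    have := abs_add_le (θ t j - θ 1 j) (θ 1 j)
    rwa [sub_add_cancel] at this
  have h6 := hS0 1 zero_le_one
  rw [Real.norm_eq_abs]
  simp only [hD] at h4 ⊢
  linarith

end MarginFlow

/-! ### The main theorem -/

theorem mainTheorem3 {d p m : ℕ}
    -- the data set, the model and the loss
    (x : Fin m → Fin d → ℝ) (y : Fin m → ℝ) (hy : ∀ i, y i = 1 ∨ y i = -1)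
    (f : (Fin d → ℝ) → (Fin p → ℝ) → ℝ) (φ : ℝ → ℝ) (hφ : IsLossExponent φ)
    (hf : ∀ a : Fin d → ℝ, ContDiff ℝ 1 (f a))
    (L : ℝ) (hL : 1 ≤ L) (hhom : IsHomogeneousModel L f)
    -- the learning rate schedule
    (η : ℝ → ℝ) (hη_pos : ∀ t, 0 ≤ t → 0 < η t)
    (hη_anti : AntitoneOn η (Set.Ici 0))
    (hη_int : Tendsto (fun T : ℝ => ∫ t in (0 : ℝ)..T, η t) atTop atTop)
    (hη_decay : η =o[atTop] fun t : ℝ => t ^ (1 / L - 1))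
    -- the Adam trajectory
    (c₁ c₂ : ℝ) (hc₂ : 0 < c₂) (hc : c₂ ≤ c₁)
    (θ g : ℝ → Fin p → ℝ) (hAdam : IsAdamTrajectory (trainLoss φ f x y) η c₁ c₂ θ g)
    -- nontrivial trajectory
    (hT1 : ∃ N : ℝ, 0 < N ∧ ∃ t₀ : ℝ, 0 ≤ t₀ ∧ ∀ t, t₀ ≤ t → N ≤ ‖θ t‖)
    -- directional convergence to a direction with positive margin
    (θbar : Fin p → ℝ) (hT2 : Tendsto (fun t => ‖θ t‖⁻¹ • θ t) atTop (𝓝 θbar))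
    (hmargin : 0 < margin f x y θbar)
    -- gradient coordinates initially bounded away from zero
    (hA1 : ∃ τ : ℝ, 0 < τ ∧ ∃ ρ : ℝ, 0 < ρ ∧ ∀ j,
      ∀ᵐ t ∂(volume.restrict (Set.Icc (0 : ℝ) τ)), ρ < g t j ^ 2) :
    ∃ θstar : Fin p → ℝ, θstar ≠ 0 ∧ IsKKTPoint f x y θstar ∧ ‖θstar‖⁻¹ • θstar = θbar := by
  have hc₁ : 0 < c₁ := hc₂.trans_le hc
  obtain ⟨N, hN, t₀, -, hlow⟩ := hT1
  -- An infimum over the empty index set is `0` in `ℝ`, so positive margin forces at least one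
  -- sample.
  have hm : NeZero m := by
    refine ⟨fun h0 => ?_⟩
    subst h0
    simp [margin] at hmargin
  have hw : ‖θbar‖ = 1 := by
    refine tendsto_nhds_unique hT2.norm (tendsto_const_nhds.congr' ?_)
    filter_upwards [eventually_ge_atTop t₀] with t ht
    have h0 : ‖θ t‖ ≠ 0 := (hN.trans_le (hlow t ht)).ne'
    rw [norm_smul, norm_inv, norm_norm, inv_mul_cancel₀ h0]
  set F : Fin m → (Fin p → ℝ) → ℝ := fun i ϑ => y i * f (x i) ϑ with hF
  have hFd : ∀ i, ContDiff ℝ 1 (F i) := fun i => contDiff_const.mul (hf (x i))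
  have hloss : trainLoss φ f x y = expLoss φ F := rfl
  obtain ⟨γ, hγ⟩ : ∃ γ, γ = margin f x y θbar := ⟨_, rfl⟩
  have hγF : γ = ⨅ i, F i θbar := by
    rw [hγ, margin, hw, inv_one, one_smul]
  have hmar : ∀ i, γ ≤ F i θbar := fun i => hγF ▸ ciInf_le (Set.finite_range _).bddBelow i
  obtain ⟨i₀, hi₀⟩ : ∃ i, F i θbar = γ := by
    rw [hγF]; exact exists_eq_ciInf_of_finite
  rw [← hγ] at hmargin
  have hθc : ContinuousOn θ (Set.Ici 0) := hAdam.arc.continuousOn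
  -- Clamping time at `0` extends the gradient path to a continuous function on `ℝ`; it agrees with
  -- `g` for `t ≥ 0`.
  set G : ℝ → Fin p → ℝ := fun t => gradVec (expLoss φ F) (θ (max t 0)) with hG
  have hGc : Continuous G :=
    (continuous_gradVec (contDiff_expLoss hφ hFd)).comp
      (hθc.comp_continuous (by fun_prop) fun t => le_max_right t 0)
  have hGj : ∀ j, Continuous fun t => G t j := fun j => (continuous_apply j).comp hGc
  have hGeq : ∀ t, 0 ≤ t → G t = gradVec (expLoss φ F) (θ t) := by
    intro t ht; simp only [hG, max_eq_left ht]
  have hgG : ∀ t, 0 ≤ t → g t = G t := by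
    intro t ht
    have h1 := hAdam.subgradient t ht
    rw [hloss, clarkeSubdiff_of_contDiff (contDiff_expLoss hφ hFd)] at h1
    rw [hGeq t ht]
    exact h1
  have hG2 : ∀ j, Continuous fun t => G t j ^ 2 := fun j => (hGj j).pow 2
  -- Positivity at time `0` alone makes every second-moment average positive for all `t > 0`, even
  -- if the coordinate vanishes later.
  have hG0 : ∀ j, 0 < G 0 j ^ 2 := by
    obtain ⟨τ, hτ, ρ, hρ, h1⟩ := hA1
    intro j
    refine pos_of_ae_lt (hG2 j) hτ hρ ?_
    filter_upwards [h1 j, ae_restrict_mem measurableSet_Icc] with t h2 h3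
    rwa [← hgG t h3.1]
  have hv : ∀ t, 0 < t → ∀ j, 0 < ema c₂ (fun s => G s j ^ 2) t := fun t ht j =>
    ema_pos hc₂ ht (hG2 j) (fun s => sq_nonneg _) (hG0 j)
  have hvhat : ∀ t, 0 < t → ∀ j, 0 < emaHat c₂ (fun s => G s j ^ 2) t := fun t ht j =>
    mul_pos (inv_pos.2 (one_sub_exp_pos hc₂ ht)) (hv t ht j)
  set U : ℝ → Fin p → ℝ := fun t j => emaHat c₁ (fun s => G s j) t /
    Real.sqrt (emaHat c₂ (fun s => G s j ^ 2) t) with hU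
  have hUc : ContinuousOn U (Set.Ioi 0) := continuousOn_pi.2 fun j =>
    (continuousOn_emaHat hc₁ (hGj j)).div (continuousOn_emaHat hc₂ (hG2 j)).sqrt
      fun t ht => (Real.sqrt_pos.2 (hvhat t ht j)).ne'
  have hUsq : ∀ t, 0 < t → ∀ j, U t j ^ 2 ≤
      ema c₁ (fun s => G s j ^ 2) t / ema c₂ (fun s => G s j ^ 2) t := fun t ht j =>
    sq_adam_direction_le hc₂ hc ht (hGj j) (hv t ht j)
  have hode : ∀ᵐ t ∂(volume.restrict (Set.Ici (0 : ℝ))), HasDerivAt θ (-η t • U t) t := by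
    filter_upwards [hAdam.ode, ae_restrict_mem measurableSet_Ici] with t h1 h2
    refine h1.congr_deriv ?_
    ext j
    simp only [Pi.smul_apply, smul_eq_mul, hU]
    rw [emaHat_congr h2 (h := fun s => g s j) (k := fun s => G s j)
        fun s hs => by rw [hgG s hs],
      emaHat_congr h2 (h := fun s => g s j ^ 2) (k := fun s => G s j ^ 2)
        fun s hs => by rw [hgG s hs]]
  obtain ⟨E, hE, hderiv⟩ := hAdam.arc.exists_countable_hasDerivAt hη_anti hUc hode
  have hC1 : 1 ≤ c₁ / c₂ := (one_le_div hc₂).2 hc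
  have hflow : MarginFlow F L η θ U (c₁ / c₂) θbar γ :=
    { contDiff := hFd
      one_le := hL
      hom := fun i ϑ α hα => by simp only [hF]; rw [hhom (x i) ϑ α hα]; ring
      rate_pos := hη_pos
      rate_anti := hη_anti
      rate_decay := hη_decay
      dir_nonneg := by positivity
      dir_le := fun t ht j => by
        refine abs_le_of_sq_le_sq ?_ (by positivity)
        refine (hUsq t ht j).trans ?_
        have h1 : ema c₁ (fun s => G s j ^ 2) t / ema c₂ (fun s => G s j ^ 2) t ≤ c₁ / c₂ :=
          (div_le_iff₀ (hv t ht j)).2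
            (ema_comparison hc₂ hc ht.le (hG2 j) fun s => sq_nonneg _)
        -- Here `c₁ / c₂ ≤ (c₁ / c₂) ^ 2`, since the ratio is at least `1`.
        nlinarith
      continuousOn := hθc
      ftc := fun H a b ha hab hH =>
        integral_gradVec_along_arc hη_anti hUc hθc hE hderiv ha hab hH
      lower := ⟨N, hN, (eventually_ge_atTop t₀).mono hlow⟩
      tendsto := hT2
      margin_pos := hmargin
      margin_le := hmar }
  obtain ⟨B, hB⟩ := hflow.exists_gradVec_expLoss_le hφ
  have hGB : ∀ j s, 0 ≤ s → G s j ^ 2 ≤ B ^ 2 := fun j s hs => by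
    rw [← sq_abs, hGeq s hs]
    exact pow_le_pow_left₀ (abs_nonneg _) (hB s hs j) 2
  choose Ψ Ψ' K hΨ hΨ' hK hle using fun j =>
    exists_ema_potential hc₂ hc (hG2 j) (fun s => sq_nonneg _) (hG0 j) (hGB j)
  obtain ⟨D, hD⟩ := hflow.exists_norm_le_integral_rate (Ψ := fun j t => Ψ j t / 2)
    (Ψ' := fun j t => Ψ' j t / 2) (K := fun j => K j / 2)
    (fun j t ht => (hΨ j t ht).div_const 2) (fun j => (hΨ' j).div_const 2)
    (fun j t ht => div_le_div_of_nonneg_right (hK j t ht) two_pos.le) fun j t ht => by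
      have h1 := (hUsq t ht j).trans ((div_le_iff₀ (hv t ht j)).2 (hle j t ht))
      -- `|u| ≤ (1 + u ^ 2) / 2` turns `u ^ 2 ≤ 1 + Ψ'` into `|u| ≤ 1 + Ψ' / 2`, which explains the
      -- halved potentials.
      nlinarith [sq_nonneg (|U t j| - 1), sq_abs (U t j)]
  obtain ⟨l, hl0, hl1, hl⟩ := hflow.exists_sum_abs_le hφ hGeq hη_int hD hi₀ fun ε hε =>
    hflow.eventually_descent hφ hGj hGeq hc₁ hc₂ (fun t _ j => rfl) hvhat hε
  refine exists_isKKTPoint_of_sum_abs_le hf hL hhom hw hmargin hmar hl0 hl1 (le_trans (le_of_eq ?_) hl)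
  refine Finset.sum_congr rfl fun j _ => ?_
  congr 1
  refine Finset.sum_congr rfl fun i _ => ?_
  have h1 : gradVec (F i) θbar j = y i * gradVec (f (x i)) θbar j :=
    gradVec_comp (G := f (x i)) (ψ := fun u => y i * u) (by simpa using (hasDerivAt_id _).const_mul (y i))
      ((hf (x i)).differentiable one_ne_zero _) j
  rw [h1, mul_assoc]
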